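/- Let $d\in\{2,3\}$, let $\Omega\subset\mathbb R^d$ be a nonempty bounded open connected convex polyhedral domain, and let $d<p\le\infty$. There is a constant $C<\infty$ depending only on $p$ and $\Omega$ such that the following holds. Let $b:\overline\Omega\to\mathbb R^d$ be Lipschitz-continuous. Let $\sigma\in H^1(\Omega)$ be an invariant measure, i.e. $-\operatorname{div}(\nabla\sigma+b\sigma)=0$ in $\Omega$ in the sense of distributions and $\inf_\Omega\sigma>0$. For $\tau\in H^1(\Omega)$ put $$|||\tau|||_p=\|\tau\|_{L^\infty(\Omega)}+\|\nabla\tau+b\tau\|_{L^p(\Omega)}\in[0,\infty],\qquad B_\tau=\nabla\tau+b\tau,$$ $$a_{\rm ss}(\tau;w,v)=\int_\Omega \tau\,\nabla w\cdot\nabla v+B_\tau\cdot\frac{(\nabla w)\,v-(\nabla v)\,w}{2}.$$ Let $\sigma_h\in H^1(\Omega)$ (an approximation of $\sigma$, for instance a $\mathbb P^1$ finite element function) be such that $|||\sigma_h|||_p<\infty$ and $\inf_\Omega\sigma_h>0$. Let $f\in L^2(\Omega)$, and let $U_H$ be a linear subspace of $H^1_0(\Omega)$. Let $u\in H^1_0(\Omega)$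 be the weak solution of $-\Delta u+b\cdot\nabla u=f$ in $\Omega$, $u=0$ on $\partial\Omega$, i.e. $$\int_\Omega\nabla u\cdot\nabla v+(b\cdot\nabla u)\,v=\int_\Omega f v\qquad\text{for all }v\in H^1_0(\Omega),$$ and let $u_H\in U_H$ satisfy $a_{\rm ss}(\sigma_h;u_H,v_H)=\int_\Omega f\,\sigma_h v_H$ for all $v_H\in U_H$. Then $$\|u-u_H\|_{H^1(\Omega)}\le\frac{C}{\inf_\Omega\sigma_h}\,\|f\|_{L^2(\Omega)}\,\|\sigma-\sigma_h\|_{L^p(\Omega)}+C\inf_{v_H\in U_H}\left[\left(1+\frac{|||\sigma|||_p}{\inf_\Omega\sigma_h}\right)\|u-v_H\|_{H^1(\Omega)}+\frac{|||\sigma-\sigma_h|||_p}{\inf_\Omega\sigma_h}\,\|v_H\|_{H^1(\Omega)}\right].$$ Here infima over $\Omega$ are essential infima, and the right-hand side is read in $[0,\infty]$ with $0\cdot\infty=0$. -/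

import Mathlib

open MeasureTheory
open scoped ENNReal NNReal ContDiff

noncomputable section

/-- Smooth functions with compact support contained in `Ω`. -/
structure IsTestFunction {d : ℕ} (Ω : Set (EuclideanSpace ℝ (Fin d)))
    (φ : EuclideanSpace ℝ (Fin d) → ℝ) : Prop where
  smooth : ContDiff ℝ ∞ φ
  compact : HasCompactSupport φ
  support_subset : tsupport φ ⊆ Ω

/-- `g` is the distributional gradient of `u` on `Ω`: for every test function `φ` and every
direction `e`, `∫_Ω u ∂_e φ = - ∫_Ω (g · e) φ`. -/
structure HasWeakGradient {d : ℕ} (Ω : Set (EuclideanSpace ℝ (Fin d)))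
    (u : EuclideanSpace ℝ (Fin d) → ℝ)
    (g : EuclideanSpace ℝ (Fin d) → EuclideanSpace ℝ (Fin d)) : Prop where
  locallyIntegrable : LocallyIntegrableOn u Ω volume
  locallyIntegrable_grad : LocallyIntegrableOn g Ω volume
  integral_eq : ∀ φ : EuclideanSpace ℝ (Fin d) → ℝ, IsTestFunction Ω φ →
    ∀ e : EuclideanSpace ℝ (Fin d),
      ∫ x in Ω, u x * fderiv ℝ φ x e = - ∫ x in Ω, inner ℝ (g x) e * φ x

open Classical in
/-- The weak gradient of `u` on `Ω` (unique almost everywhere on `Ω` when it exists;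
`0` if there is none). -/
def weakGrad {d : ℕ} (Ω : Set (EuclideanSpace ℝ (Fin d)))
    (u : EuclideanSpace ℝ (Fin d) → ℝ) :
    EuclideanSpace ℝ (Fin d) → EuclideanSpace ℝ (Fin d) :=
  if h : ∃ g, HasWeakGradient Ω u g then h.choose else 0

/-- `u ∈ H¹(Ω)`. -/
structure MemH1 {d : ℕ} (Ω : Set (EuclideanSpace ℝ (Fin d)))
    (u : EuclideanSpace ℝ (Fin d) → ℝ) : Prop where
  hasWeakGradient : HasWeakGradient Ω u (weakGrad Ω u)
  memLp : MemLp u 2 (volume.restrict Ω)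
  memLp_grad : MemLp (weakGrad Ω u) 2 (volume.restrict Ω)

/-- The norm `(‖u‖²_{L²(Ω)} + ‖∇u‖²_{L²(Ω)})^{1/2}` of `H¹(Ω)`. -/
def eH1norm {d : ℕ} (Ω : Set (EuclideanSpace ℝ (Fin d)))
    (u : EuclideanSpace ℝ (Fin d) → ℝ) : ℝ≥0∞ :=
  (eLpNorm u 2 (volume.restrict Ω) ^ 2
    + eLpNorm (weakGrad Ω u) 2 (volume.restrict Ω) ^ 2) ^ (1 / 2 : ℝ)

/-- `u ∈ H¹₀(Ω)`, the closure of the test functions in `H¹(Ω)`. -/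
structure MemH10 {d : ℕ} (Ω : Set (EuclideanSpace ℝ (Fin d)))
    (u : EuclideanSpace ℝ (Fin d) → ℝ) : Prop where
  memH1 : MemH1 Ω u
  approx : ∀ ε : ℝ≥0∞, 0 < ε → ∃ φ, IsTestFunction Ω φ ∧ eH1norm Ω (u - φ) < ε

/-- `Ω` is the intersection of finitely many open half-spaces: for a bounded nonempty set,
this says that `Ω` is an open convex polyhedron. -/
def IsConvexPolyhedral {d : ℕ} (Ω : Set (EuclideanSpace ℝ (Fin d))) : Prop :=
  ∃ s : Finset (EuclideanSpace ℝ (Fin d) × ℝ), Ω = {x | ∀ q ∈ s, inner ℝ q.1 x < q.2}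

/-- The field `B = ∇σ + σ b`. -/
def flux {d : ℕ} (Ω : Set (EuclideanSpace ℝ (Fin d)))
    (b : EuclideanSpace ℝ (Fin d) → EuclideanSpace ℝ (Fin d))
    (σ : EuclideanSpace ℝ (Fin d) → ℝ) :
    EuclideanSpace ℝ (Fin d) → EuclideanSpace ℝ (Fin d) :=
  fun x => weakGrad Ω σ x + σ x • b x

/-- `|||σ|||_p = ‖σ‖_{L^∞(Ω)} + ‖∇σ + b σ‖_{L^p(Ω)}`. -/
def tripleNorm {d : ℕ} (Ω : Set (EuclideanSpace ℝ (Fin d)))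
    (b : EuclideanSpace ℝ (Fin d) → EuclideanSpace ℝ (Fin d)) (p : ℝ≥0∞)
    (σ : EuclideanSpace ℝ (Fin d) → ℝ) : ℝ≥0∞ :=
  eLpNorm σ ⊤ (volume.restrict Ω) + eLpNorm (flux Ω b σ) p (volume.restrict Ω)

/-- `σ` is an invariant measure of `-Δ + b · ∇`: `σ ∈ H¹(Ω)`, `-div (∇σ + b σ) = 0` in the sense
of distributions in `Ω`, and `inf_Ω σ > 0`. No boundary condition is imposed on `σ`. -/
structure IsInvariantMeasure {d : ℕ} (Ω : Set (EuclideanSpace ℝ (Fin d)))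
    (b : EuclideanSpace ℝ (Fin d) → EuclideanSpace ℝ (Fin d))
    (σ : EuclideanSpace ℝ (Fin d) → ℝ) : Prop where
  memH1 : MemH1 Ω σ
  div_eq_zero : ∀ φ, IsTestFunction Ω φ → ∫ x in Ω, fderiv ℝ φ x (flux Ω b σ x) = 0
  inf_pos : 0 < essInf σ (volume.restrict Ω)

/-- `a(u,v) = ∫_Ω ∇u · ∇v + (b · ∇u) v`. -/
def advDiffForm {d : ℕ} (Ω : Set (EuclideanSpace ℝ (Fin d)))
    (b : EuclideanSpace ℝ (Fin d) → EuclideanSpace ℝ (Fin d))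
    (u v : EuclideanSpace ℝ (Fin d) → ℝ) : ℝ :=
  ∫ x in Ω, (inner ℝ (weakGrad Ω u x) (weakGrad Ω v x)
    + inner ℝ (b x) (weakGrad Ω u x) * v x)

/-- `u` is the weak solution of `-Δu + b · ∇u = f` in `Ω`, `u = 0` on `∂Ω`. -/
structure IsWeakSolution {d : ℕ} (Ω : Set (EuclideanSpace ℝ (Fin d)))
    (b : EuclideanSpace ℝ (Fin d) → EuclideanSpace ℝ (Fin d))
    (f u : EuclideanSpace ℝ (Fin d) → ℝ) : Prop where
  memH10 : MemH10 Ω u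
  eq : ∀ v, MemH10 Ω v → advDiffForm Ω b u v = ∫ x in Ω, f x * v x

/-- `a_ss(σ;u,v) = ∫_Ω σ ∇u · ∇v + B · ((∇u) v - (∇v) u) / 2` with `B = ∇σ + σ b`. -/
def skewForm {d : ℕ} (Ω : Set (EuclideanSpace ℝ (Fin d)))
    (b : EuclideanSpace ℝ (Fin d) → EuclideanSpace ℝ (Fin d))
    (σ u v : EuclideanSpace ℝ (Fin d) → ℝ) : ℝ :=
  ∫ x in Ω, (σ x * inner ℝ (weakGrad Ω u x) (weakGrad Ω v x)
    + inner ℝ (flux Ω b σ x) (v x • weakGrad Ω u x - u x • weakGrad Ω v x) / 2)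

/-- `uH ∈ UH` solves the discrete problem `a_ss(σh;uH,vH) = ∫_Ω f σh vH` for all `vH ∈ UH`. -/
structure IsDiscreteSolution {d : ℕ} (Ω : Set (EuclideanSpace ℝ (Fin d)))
    (b : EuclideanSpace ℝ (Fin d) → EuclideanSpace ℝ (Fin d))
    (f σh : EuclideanSpace ℝ (Fin d) → ℝ)
    (UH : Submodule ℝ (EuclideanSpace ℝ (Fin d) → ℝ))
    (uH : EuclideanSpace ℝ (Fin d) → ℝ) : Prop where
  mem : uH ∈ UH
  eq : ∀ vH ∈ UH, skewForm Ω b σh uH vH = ∫ x in Ω, f x * (σh x * vH x)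

end

/-! The estimate is a Strang-type argument for the skew-symmetrised form, resting on three facts.

Continuity. Put 1/q = 1/2 - 1/p. Since p > d, the exponent q is strictly subcritical, so the `L^q`
norm on `H¹₀(Ω)` is bounded by C times the `L²` norm of the gradient (`MemH10.exists_sobolev`).
Hölder with exponents p, q, 2 then bounds a_ss(τ;w,v) by (1 + 2C) |||τ|||_p ‖∇w‖ ‖∇v‖
(`enorm_skewForm_le`). The field b enters only through the triple norm, so the constant does not
depend on b.

Coercivity. On the diagonal the skew part cancels and a_ss(τ;w,w) = ∫ τ |∇w|² ≥ (inf τ) ‖∇w‖²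
(`ofReal_essInf_mul_le_enorm_skewForm`).

Consistency. If σ is an invariant measure with finite triple norm, then a_ss(σ;u,v) = ∫ f σ v for
all v in `H¹₀(Ω)` (`IsInvariantMeasure.skewForm_weakSolution`). For a test function v = φ this is
the equation for u tested with φσ, minus half of the identity ∫ B · ∇(φu) = 0; general v follows by
density. As φσ is only a compactly supported `H¹` function, admitting it as a test function takes a
mollification argument.

With w = u_H - v_H the three facts combine through a_ss(σ_h;w,w) = a_ss(σ;u - v_H,w) + a_ss(σ -
σ_h;v_H,w) - ∫ f (σ - σ_h) w, and the triangle inequality with Poincaré's inequality passes from w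
to u - u_H.

If |||σ|||_p = ∞, then |||σ - σ_h|||_p = ∞ as well, and the right-hand side is infinite except when
u - v_H and v_H both vanish in `H¹`. In that case f = 0, and coercivity forces u_H = 0. -/

section

variable {d : ℕ} {Ω : Set (EuclideanSpace ℝ (Fin d))}
  {b : EuclideanSpace ℝ (Fin d) → EuclideanSpace ℝ (Fin d)}

/-! ### Calculus of test functions and weak gradients; the `H¹` norm. -/

namespace IsTestFunction

variable {φ ψ : EuclideanSpace ℝ (Fin d) → ℝ}

theorem differentiable (h : IsTestFunction Ω φ) : Differentiable ℝ φ :=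
  h.smooth.differentiable (by simp)

theorem continuous_fderiv (h : IsTestFunction Ω φ) : Continuous (fderiv ℝ φ) :=
  h.smooth.continuous_fderiv (by simp)

theorem mul_smooth (h : IsTestFunction Ω φ) (hψ : ContDiff ℝ ∞ ψ) :
    IsTestFunction Ω (fun x => φ x * ψ x) where
  smooth := h.smooth.mul hψ
  compact := h.compact.mul_right
  support_subset := (tsupport_mul_subset_left).trans h.support_subset

theorem continuous_gradient (h : IsTestFunction Ω φ) : Continuous (gradient φ) :=
  (InnerProductSpace.toDual ℝ (EuclideanSpace ℝ (Fin d))).symm.continuous.comp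
    h.continuous_fderiv

theorem hasCompactSupport_gradient (h : IsTestFunction Ω φ) : HasCompactSupport (gradient φ) :=
  (h.compact.fderiv ℝ).comp_left (g := (InnerProductSpace.toDual ℝ
    (EuclideanSpace ℝ (Fin d))).symm) (map_zero _)

theorem hasWeakGradient (h : IsTestFunction Ω φ) : HasWeakGradient Ω φ (gradient φ) where
  locallyIntegrable := (h.smooth.continuous.locallyIntegrable).locallyIntegrableOn _
  locallyIntegrable_grad := (h.continuous_gradient.locallyIntegrable).locallyIntegrableOn _
  integral_eq := by
    intro ψ hψ e
    rw [setIntegral_eq_integral_of_forall_compl_eq_zero,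
      setIntegral_eq_integral_of_forall_compl_eq_zero]
    · have key := integral_mul_fderiv_eq_neg_fderiv_mul_of_integrable (μ := volume)
        (f := φ) (g := ψ) (v := e) ?_ ?_ ?_ (fun x _ => h.differentiable x)
          (fun x _ => hψ.differentiable x)
      · rw [key]
        simp [gradient]
      · exact ((h.continuous_fderiv.clm_apply continuous_const).mul
          hψ.smooth.continuous).integrable_of_hasCompactSupport hψ.compact.mul_left
      · exact (h.smooth.continuous.mul
          (hψ.continuous_fderiv.clm_apply continuous_const)).integrable_of_hasCompactSupport
          h.compact.mul_right
      · exact (h.smooth.continuous.mul hψ.smooth.continuous).integrable_of_hasCompactSupport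
          hψ.compact.mul_left
    · intro x hx
      rw [image_eq_zero_of_notMem_tsupport fun hx' => hx (hψ.support_subset hx'), mul_zero]
    · intro x hx
      rw [image_eq_zero_of_notMem_tsupport fun hx' => hx (h.support_subset hx'), zero_mul]

end IsTestFunction

theorem MeasureTheory.LocallyIntegrableOn.integrable_smul_of_hasCompactSupport
    {F : Type*} [NormedAddCommGroup F] [NormedSpace ℝ F]
    {g : EuclideanSpace ℝ (Fin d) → F}
    (hg : LocallyIntegrableOn g Ω volume) {c : EuclideanSpace ℝ (Fin d) → ℝ}
    (hc : Continuous c) (hcc : HasCompactSupport c) (hs : tsupport c ⊆ Ω) :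
    Integrable (fun x => c x • g x) := by
  have h1 : IntegrableOn (fun x => c x • g x) (tsupport c) volume :=
    (hg.integrableOn_compact_subset hs hcc).continuousOn_smul hc.continuousOn hcc
  rw [← integrableOn_iff_integrable_of_support_subset (s := tsupport c)]
  · exact h1
  · intro x hx
    by_contra hx'
    exact hx (by simp [image_eq_zero_of_notMem_tsupport hx'])

namespace HasWeakGradient

variable {u v : EuclideanSpace ℝ (Fin d) → ℝ}
  {g g' : EuclideanSpace ℝ (Fin d) → EuclideanSpace ℝ (Fin d)}

theorem integrable_mul_fderiv (h : HasWeakGradient Ω u g) {φ : EuclideanSpace ℝ (Fin d) → ℝ}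
    (hφ : IsTestFunction Ω φ) (e : EuclideanSpace ℝ (Fin d)) :
    Integrable (fun x => u x * fderiv ℝ φ x e) (volume.restrict Ω) := by
  have hs : tsupport (fun x => fderiv ℝ φ x e) ⊆ tsupport φ :=
    closure_minimal (fun x hx => by
      by_contra hx'
      exact hx (by simp [image_eq_zero_of_notMem_tsupport
        (fun h => hx' (tsupport_fderiv_subset ℝ h))])) (isClosed_tsupport _)
  have := h.locallyIntegrable.integrable_smul_of_hasCompactSupport
    (hφ.continuous_fderiv.clm_apply (continuous_const (y := e)))
    (hφ.compact.mono' ((subset_tsupport _).trans hs)) (hs.trans hφ.support_subset)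
  simpa [mul_comm] using this.restrict (s := Ω)

theorem integrable_inner_mul (h : HasWeakGradient Ω u g) {φ : EuclideanSpace ℝ (Fin d) → ℝ}
    (hφ : IsTestFunction Ω φ) (e : EuclideanSpace ℝ (Fin d)) :
    Integrable (fun x => inner ℝ (g x) e * φ x) (volume.restrict Ω) := by
  have := (h.locallyIntegrable_grad.integrable_smul_of_hasCompactSupport hφ.smooth.continuous
    hφ.compact hφ.support_subset).restrict (s := Ω) |>.inner_const (𝕜 := ℝ) e
  simpa [inner_smul_left, mul_comm] using this

theorem add (h : HasWeakGradient Ω u g) (h' : HasWeakGradient Ω v g') :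
    HasWeakGradient Ω (u + v) (g + g') where
  locallyIntegrable := h.locallyIntegrable.add h'.locallyIntegrable
  locallyIntegrable_grad := h.locallyIntegrable_grad.add h'.locallyIntegrable_grad
  integral_eq := by
    intro φ hφ e
    simp only [Pi.add_apply, add_mul, inner_add_left]
    rw [integral_add (h.integrable_mul_fderiv hφ e) (h'.integrable_mul_fderiv hφ e),
      integral_add (h.integrable_inner_mul hφ e) (h'.integrable_inner_mul hφ e),
      h.integral_eq φ hφ e, h'.integral_eq φ hφ e]
    ring

theorem neg (h : HasWeakGradient Ω u g) : HasWeakGradient Ω (-u) (-g) where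
  locallyIntegrable := h.locallyIntegrable.neg
  locallyIntegrable_grad := h.locallyIntegrable_grad.neg
  integral_eq := by
    intro φ hφ e
    simp only [Pi.neg_apply, neg_mul, inner_neg_left, integral_neg, h.integral_eq φ hφ e]

theorem sub (h : HasWeakGradient Ω u g) (h' : HasWeakGradient Ω v g') :
    HasWeakGradient Ω (u - v) (g - g') := by
  simpa [sub_eq_add_neg] using h.add h'.neg

/-- The difference g - g' is a weak gradient of u - u = 0, hence orthogonal to every test function,
and the fundamental lemma of the calculus of variations applies. This makes the chosen
representative `weakGrad` interchangeable with any weak gradient at hand. -/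
theorem ae_eq (hΩ : IsOpen Ω) (h : HasWeakGradient Ω u g) (h' : HasWeakGradient Ω u g') :
    g =ᵐ[volume.restrict Ω] g' := by
  have hz : HasWeakGradient Ω (u - u) (g - g') := h.sub h'
  rw [Filter.EventuallyEq, ae_restrict_iff' hΩ.measurableSet]
  have := hΩ.ae_eq_zero_of_integral_contDiff_smul_eq_zero (f := g - g') (μ := volume)
    hz.locallyIntegrable_grad ?_
  · filter_upwards [this] with x hx hxΩ
    simpa [sub_eq_zero] using hx hxΩ
  · intro φ h1 h2 h3
    have hφ : IsTestFunction Ω φ := ⟨h1, h2, h3⟩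
    rw [← setIntegral_eq_integral_of_forall_compl_eq_zero (s := Ω)]
    · refine ext_inner_right ℝ fun e => ?_
      have hi := hz.locallyIntegrable_grad.integrable_smul_of_hasCompactSupport h1.continuous h2 h3
        |>.restrict (s := Ω)
      have := hz.integral_eq φ hφ e
      simp only [sub_self, Pi.zero_apply, zero_mul, integral_zero] at this
      rw [inner_zero_left, real_inner_comm, ← integral_inner hi e]
      rw [eq_comm, neg_eq_zero] at this
      rw [← this]
      refine integral_congr_ae (.of_forall fun x => ?_)
      simp [real_inner_comm, inner_smul_right, mul_comm]
    · intro x hx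
      rw [image_eq_zero_of_notMem_tsupport fun hx' => hx (h3 hx'), zero_smul]

theorem weakGrad_ae_eq (hΩ : IsOpen Ω) (h : HasWeakGradient Ω u g) :
    weakGrad Ω u =ᵐ[volume.restrict Ω] g := by
  have hex : ∃ g, HasWeakGradient Ω u g := ⟨g, h⟩
  rw [weakGrad, dif_pos hex]
  exact hex.choose_spec.ae_eq hΩ h

theorem hasWeakGradient_weakGrad (h : HasWeakGradient Ω u g) :
    HasWeakGradient Ω u (weakGrad Ω u) := by
  have hex : ∃ g, HasWeakGradient Ω u g := ⟨g, h⟩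
  rw [weakGrad, dif_pos hex]
  exact hex.choose_spec

theorem memH1 (hΩ : IsOpen Ω) (h : HasWeakGradient Ω u g) (hu : MemLp u 2 (volume.restrict Ω))
    (hg : MemLp g 2 (volume.restrict Ω)) : MemH1 Ω u :=
  ⟨h.hasWeakGradient_weakGrad, hu, hg.ae_eq (h.weakGrad_ae_eq hΩ).symm⟩

end HasWeakGradient

namespace MemH1

variable {u v : EuclideanSpace ℝ (Fin d) → ℝ}

theorem weakGrad_sub (hΩ : IsOpen Ω) (hu : MemH1 Ω u) (hv : MemH1 Ω v) :
    weakGrad Ω (u - v) =ᵐ[volume.restrict Ω] weakGrad Ω u - weakGrad Ω v :=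
  (hu.hasWeakGradient.sub hv.hasWeakGradient).weakGrad_ae_eq hΩ

theorem sub (hΩ : IsOpen Ω) (hu : MemH1 Ω u) (hv : MemH1 Ω v) : MemH1 Ω (u - v) :=
  (hu.hasWeakGradient.sub hv.hasWeakGradient).memH1 hΩ (hu.memLp.sub hv.memLp)
    (hu.memLp_grad.sub hv.memLp_grad)

end MemH1

namespace IsTestFunction

variable {φ : EuclideanSpace ℝ (Fin d) → ℝ}

theorem weakGrad_ae_eq (hΩ : IsOpen Ω) (h : IsTestFunction Ω φ) :
    weakGrad Ω φ =ᵐ[volume.restrict Ω] gradient φ :=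
  h.hasWeakGradient.weakGrad_ae_eq hΩ

theorem memH1 (hΩ : IsOpen Ω) (h : IsTestFunction Ω φ) : MemH1 Ω φ :=
  h.hasWeakGradient.memH1 hΩ
    ((h.smooth.continuous.memLp_of_hasCompactSupport h.compact).restrict _)
    ((h.continuous_gradient.memLp_of_hasCompactSupport h.hasCompactSupport_gradient).restrict _)

end IsTestFunction

theorem ENNReal.sq_rpow_half (a : ℝ≥0∞) : (a ^ 2) ^ (1 / 2 : ℝ) = a := by
  rw [← ENNReal.rpow_natCast, ← ENNReal.rpow_mul]
  norm_num

theorem eLpNorm_le_eH1norm (Ω : Set (EuclideanSpace ℝ (Fin d)))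
    (u : EuclideanSpace ℝ (Fin d) → ℝ) :
    eLpNorm u 2 (volume.restrict Ω) ≤ eH1norm Ω u := by
  conv_lhs => rw [← ENNReal.sq_rpow_half (eLpNorm u 2 (volume.restrict Ω))]
  exact ENNReal.rpow_le_rpow le_self_add (by norm_num)

theorem eLpNorm_weakGrad_le_eH1norm (Ω : Set (EuclideanSpace ℝ (Fin d)))
    (u : EuclideanSpace ℝ (Fin d) → ℝ) :
    eLpNorm (weakGrad Ω u) 2 (volume.restrict Ω) ≤ eH1norm Ω u := by
  conv_lhs => rw [← ENNReal.sq_rpow_half (eLpNorm (weakGrad Ω u) 2 (volume.restrict Ω))]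
  exact ENNReal.rpow_le_rpow le_add_self (by norm_num)

theorem eH1norm_le (Ω : Set (EuclideanSpace ℝ (Fin d)))
    (u : EuclideanSpace ℝ (Fin d) → ℝ) :
    eH1norm Ω u ≤ eLpNorm u 2 (volume.restrict Ω)
      + eLpNorm (weakGrad Ω u) 2 (volume.restrict Ω) := by
  conv_rhs => rw [← ENNReal.sq_rpow_half (_ + _)]
  refine ENNReal.rpow_le_rpow ?_ (by norm_num)
  rw [add_sq]
  gcongr
  exact le_self_add

/-! ### Sobolev and Poincaré inequalities on `H¹₀(Ω)`. -/

theorem IsTestFunction.exists_sobolev (hd : 2 ≤ d) (hb : Bornology.IsBounded Ω)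
    {p : ℝ≥0∞} (hp : (d : ℝ≥0∞) < p) :
    ∃ q : ℝ≥0, ENNReal.HolderTriple p q 2 ∧ 2 ≤ q ∧ ∃ C : ℝ≥0, ∀ φ, IsTestFunction Ω φ →
      eLpNorm φ q (volume.restrict Ω)
        ≤ C * eLpNorm (gradient φ) 2 (volume.restrict Ω) := by
  have hd0 : (0 : ℝ≥0) < d := by exact_mod_cast (by omega : 0 < d)
  obtain ⟨s, hs⟩ : ∃ s : ℝ≥0, (s : ℝ≥0∞) = p⁻¹ :=
    ⟨(p⁻¹).toNNReal, ENNReal.coe_toNNReal (by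
      simpa using (lt_of_le_of_lt (zero_le) hp).ne')⟩
  have hsd : s < (d : ℝ≥0)⁻¹ := by
    rw [← ENNReal.coe_lt_coe, hs, ENNReal.coe_inv hd0.ne', ENNReal.inv_lt_inv]
    simpa using hp
  have hd2 : (d : ℝ≥0)⁻¹ ≤ 2⁻¹ := by
    gcongr
    exact_mod_cast hd
  have hs2 : s < 2⁻¹ := hsd.trans_le hd2
  have hpos : 0 < 2⁻¹ - s := tsub_pos_of_lt hs2
  have hfin : IsFiniteMeasure (volume.restrict Ω) :=
    ⟨by simpa using hb.measure_lt_top⟩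
  -- With s = 1/p the exponents satisfy 1/q = 1/2 - 1/p and 1/r = 1/q + 1/d.
  -- Gagliardo–Nirenberg–Sobolev is used from `L^r` to `L^q`, and boundedness of Ω replaces `L^r` by
  -- `L²` on the gradient. The condition s < 1/d gives r < 2 ≤ d, so the Sobolev inequality applies
  -- even when d = 2.
  set q : ℝ≥0 := (2⁻¹ - s)⁻¹ with hq
  set r : ℝ≥0 := (2⁻¹ + ((d : ℝ≥0)⁻¹ - s))⁻¹ with hr
  have hr0 : 0 < 2⁻¹ + ((d : ℝ≥0)⁻¹ - s) := by positivity
  have hr1 : 1 ≤ r := by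
    rw [hr, one_le_inv₀ hr0]
    calc (2 : ℝ≥0)⁻¹ + ((d : ℝ≥0)⁻¹ - s) ≤ 2⁻¹ + 2⁻¹ := by
          gcongr
          exact tsub_le_self.trans hd2
      _ = 1 := by rw [← NNReal.coe_inj]; norm_num
  have hr2 : r < 2 := by
    rw [hr, inv_lt_comm₀ hr0 (by norm_num)]
    exact lt_add_of_pos_right _ (tsub_pos_of_lt hsd)
  refine ⟨q, ⟨?_⟩, ?_, ?_⟩
  · rw [← hs, ← ENNReal.coe_inv (by positivity), hq, inv_inv, ← ENNReal.coe_add,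
      add_tsub_cancel_of_le hs2.le, ENNReal.coe_inv (by norm_num)]
    norm_num
  · rw [hq, le_inv_comm₀ (by norm_num) hpos]
    exact tsub_le_self
  · refine ⟨eLpNormLESNormFDerivOfLeConst ℝ volume Ω r q
      * (volume.restrict Ω Set.univ ^ (1 / (r : ℝ≥0∞).toReal - 1 / (2 : ℝ≥0∞).toReal)).toNNReal,
      fun φ hφ => ?_⟩
    have hsupp : Function.support φ ⊆ Ω := (subset_tsupport φ).trans hφ.support_subset
    have hS := eLpNorm_le_eLpNorm_fderiv_of_le (F := ℝ) (volume) (u := φ) (s := Ω)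
      (hφ.smooth.of_le (by simp)) hsupp (p := r) (q := q) hr1 ?_ ?_ hb
    · have hsf : Function.support (fderiv ℝ φ) ⊆ Ω :=
        (support_fderiv_subset ℝ).trans hφ.support_subset
      rw [eLpNorm_restrict_eq_of_support_subset hsupp]
      refine hS.trans ?_
      rw [← eLpNorm_restrict_eq_of_support_subset (f := fderiv ℝ φ) hsf, ENNReal.coe_mul, mul_assoc]
      gcongr
      rw [ENNReal.coe_toNNReal]
      · rw [mul_comm, eLpNorm_congr_norm_ae (g := fderiv ℝ φ) (f := gradient φ)
          (.of_forall fun x => by simp [gradient])]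
        exact eLpNorm_le_eLpNorm_mul_rpow_measure_univ (by exact_mod_cast hr2.le)
          hφ.continuous_fderiv.aestronglyMeasurable
      · refine ENNReal.rpow_ne_top_of_nonneg ?_ (measure_ne_top _ _)
        simp only [ENNReal.coe_toReal, ENNReal.toReal_ofNat, one_div, sub_nonneg]
        gcongr
        exact_mod_cast hr2.le
    · simp only [finrank_euclideanSpace, Fintype.card_fin]
      exact hr2.trans_le (by exact_mod_cast hd)
    · simp only [finrank_euclideanSpace, Fintype.card_fin, hr, hq, inv_inv, NNReal.coe_add,
        NNReal.coe_sub hsd.le, NNReal.coe_sub hs2.le, NNReal.coe_inv]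
      simp only [NNReal.coe_natCast, NNReal.coe_ofNat]
      linarith

theorem MemH10.exists_seq {w : EuclideanSpace ℝ (Fin d) → ℝ} (hw : MemH10 Ω w) :
    ∃ φ : ℕ → EuclideanSpace ℝ (Fin d) → ℝ, (∀ n, IsTestFunction Ω (φ n)) ∧
      Filter.Tendsto (fun n => eH1norm Ω (w - φ n)) Filter.atTop (nhds 0) := by
  choose φ hφ hlt using fun n : ℕ => hw.approx ((n : ℝ≥0∞)⁻¹) (by simp)
  exact ⟨φ, hφ, tendsto_of_tendsto_of_tendsto_of_le_of_le tendsto_const_nhds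
    ENNReal.tendsto_inv_nat_nhds_zero (fun _ => zero_le) fun n => (hlt n).le⟩

theorem IsTestFunction.eLpNorm_gradient_le (hΩ : IsOpen Ω)
    {w φ : EuclideanSpace ℝ (Fin d) → ℝ} (hw : MemH1 Ω w) (hφ : IsTestFunction Ω φ) :
    eLpNorm (gradient φ) 2 (volume.restrict Ω)
      ≤ eLpNorm (weakGrad Ω w) 2 (volume.restrict Ω) + eH1norm Ω (w - φ) := by
  have h1 : gradient φ =ᵐ[volume.restrict Ω] weakGrad Ω w - weakGrad Ω (w - φ) := by
    filter_upwards [hφ.weakGrad_ae_eq hΩ, hw.weakGrad_sub hΩ (hφ.memH1 hΩ)] with x h1 h2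
    simp [h2, ← h1]
  rw [eLpNorm_congr_ae h1]
  refine (eLpNorm_sub_le hw.memLp_grad.1 (hw.sub hΩ (hφ.memH1 hΩ)).memLp_grad.1
    (by norm_num)).trans ?_
  gcongr
  exact eLpNorm_weakGrad_le_eH1norm _ _

/-- Fatou's lemma: a subsequence of approximating test functions converges almost everywhere, and
their gradient norms exceed that of w by at most a quantity tending to 0. Membership of w in `L^q`
is thus a conclusion. -/
theorem MemH10.eLpNorm_le_of_test (hΩ : IsOpen Ω) {q : ℝ≥0∞} {C : ℝ≥0}
    (h : ∀ φ, IsTestFunction Ω φ → eLpNorm φ q (volume.restrict Ω)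
        ≤ C * eLpNorm (gradient φ) 2 (volume.restrict Ω))
    {w : EuclideanSpace ℝ (Fin d) → ℝ} (hw : MemH10 Ω w) :
    eLpNorm w q (volume.restrict Ω) ≤ C * eLpNorm (weakGrad Ω w) 2 (volume.restrict Ω) := by
  obtain ⟨φ, hφ, hlim⟩ := hw.exists_seq
  have hL2 : Filter.Tendsto (fun n => eLpNorm (φ n - w) 2 (volume.restrict Ω))
      Filter.atTop (nhds 0) :=
    tendsto_of_tendsto_of_tendsto_of_le_of_le tendsto_const_nhds hlim (fun _ => zero_le)
      fun n => by rw [eLpNorm_sub_comm]; exact eLpNorm_le_eH1norm _ _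
  obtain ⟨ns, hns, hae⟩ := (tendstoInMeasure_of_tendsto_eLpNorm (by norm_num)
    (fun n => ((hφ n).memH1 hΩ).memLp.1) hw.memH1.memLp.1 hL2).exists_seq_tendsto_ae
  refine (Lp.eLpNorm_lim_le_liminf_eLpNorm (fun n => ((hφ (ns n)).memH1 hΩ).memLp.1) w
    hae).trans ?_
  have hT : Filter.Tendsto (fun n => (C : ℝ≥0∞) * (eLpNorm (weakGrad Ω w) 2 (volume.restrict Ω)
      + eH1norm Ω (w - φ (ns n)))) Filter.atTop
      (nhds (C * (eLpNorm (weakGrad Ω w) 2 (volume.restrict Ω) + 0))) :=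
    ENNReal.Tendsto.const_mul (tendsto_const_nhds.add (hlim.comp hns.tendsto_atTop))
      (Or.inr ENNReal.coe_ne_top)
  rw [add_zero] at hT
  rw [← hT.liminf_eq]
  refine Filter.liminf_le_liminf (.of_forall fun n => (h _ (hφ _)).trans ?_)
  gcongr
  exact (hφ _).eLpNorm_gradient_le hΩ hw.memH1

theorem MemH10.exists_sobolev (hd : 2 ≤ d) (hΩ : IsOpen Ω) (hb : Bornology.IsBounded Ω)
    {p : ℝ≥0∞} (hp : (d : ℝ≥0∞) < p) :
    ∃ q : ℝ≥0∞, ENNReal.HolderTriple p q 2 ∧ ∃ C : ℝ≥0, ∀ w, MemH10 Ω w →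
      eLpNorm w q (volume.restrict Ω)
        ≤ C * eLpNorm (weakGrad Ω w) 2 (volume.restrict Ω) ∧
      eLpNorm w 2 (volume.restrict Ω)
        ≤ C * eLpNorm (weakGrad Ω w) 2 (volume.restrict Ω) := by
  obtain ⟨q, hpq, hq2, C, hC⟩ := IsTestFunction.exists_sobolev hd hb hp
  have hfin : IsFiniteMeasure (volume.restrict Ω) :=
    ⟨by simpa using hb.measure_lt_top⟩
  set M := volume.restrict Ω Set.univ ^ (1 / (2 : ℝ≥0∞).toReal - 1 / (q : ℝ≥0∞).toReal) with hM
  have hMt : M ≠ ⊤ := by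
    refine ENNReal.rpow_ne_top_of_nonneg ?_ (measure_ne_top _ _)
    simp only [ENNReal.coe_toReal, ENNReal.toReal_ofNat, one_div, sub_nonneg]
    gcongr
    exact_mod_cast hq2
  refine ⟨q, hpq, C + C * M.toNNReal, fun w hw => ?_⟩
  have h1 := hw.eLpNorm_le_of_test hΩ hC
  refine ⟨h1.trans ?_, ?_⟩
  · gcongr
    exact_mod_cast le_self_add
  -- Poincaré's inequality follows from the `L^q` bound because q ≥ 2 and Ω has finite measure.
  · refine (eLpNorm_le_eLpNorm_mul_rpow_measure_univ (q := q) (by exact_mod_cast hq2)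
      hw.memH1.memLp.1).trans ?_
    rw [← hM, ENNReal.coe_add, ENNReal.coe_mul, ENNReal.coe_toNNReal hMt, add_mul]
    refine le_trans ?_ le_add_self
    calc _ ≤ C * eLpNorm (weakGrad Ω w) 2 (volume.restrict Ω) * M := by gcongr
      _ = _ := by ring

/-! ### Continuity and algebra of the skew-symmetrised form. -/

/-- The integrand of `skewForm`. -/
noncomputable def skewDensity (Ω : Set (EuclideanSpace ℝ (Fin d)))
    (b : EuclideanSpace ℝ (Fin d) → EuclideanSpace ℝ (Fin d))
    (σ u v : EuclideanSpace ℝ (Fin d) → ℝ) (x : EuclideanSpace ℝ (Fin d)) : ℝ :=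
  σ x * inner ℝ (weakGrad Ω u x) (weakGrad Ω v x)
    + inner ℝ (flux Ω b σ x) (v x • weakGrad Ω u x - u x • weakGrad Ω v x) / 2

theorem skewForm_eq (σ u v : EuclideanSpace ℝ (Fin d) → ℝ) :
    skewForm Ω b σ u v = ∫ x in Ω, skewDensity Ω b σ u v x := rfl

theorem MemH1.aestronglyMeasurable_flux {τ : EuclideanSpace ℝ (Fin d) → ℝ} (hτ : MemH1 Ω τ)
    (hb : AEStronglyMeasurable b (volume.restrict Ω)) :
    AEStronglyMeasurable (flux Ω b τ) (volume.restrict Ω) :=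
  hτ.memLp_grad.1.add (hτ.memLp.1.smul hb)

theorem MemH1.flux_sub (hΩ : IsOpen Ω) {σ τ : EuclideanSpace ℝ (Fin d) → ℝ} (hσ : MemH1 Ω σ)
    (hτ : MemH1 Ω τ) :
    flux Ω b (σ - τ) =ᵐ[volume.restrict Ω] flux Ω b σ - flux Ω b τ := by
  filter_upwards [hσ.weakGrad_sub hΩ hτ] with x hx
  simp only [flux, hx, Pi.sub_apply, sub_smul]
  abel

/-- Serves the degenerate case: an infinite triple norm of σ passes to σ - τ when that of τ is
finite. -/
theorem MemH1.tripleNorm_le_add (hΩ : IsOpen Ω) {p : ℝ≥0∞} (hp : 1 ≤ p)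
    {σ τ : EuclideanSpace ℝ (Fin d) → ℝ}
    (hσ : MemH1 Ω σ) (hτ : MemH1 Ω τ) (hb : AEStronglyMeasurable b (volume.restrict Ω)) :
    tripleNorm Ω b p σ ≤ tripleNorm Ω b p (σ - τ) + tripleNorm Ω b p τ := by
  have hστ := hσ.sub hΩ hτ
  have h1 := eLpNorm_add_le hστ.memLp.1 hτ.memLp.1 (p := ⊤) (by simp)
  have h2 := eLpNorm_add_le (hστ.aestronglyMeasurable_flux hb)
    (hτ.aestronglyMeasurable_flux hb) hp
  rw [sub_add_cancel] at h1
  have h3 : flux Ω b σ =ᵐ[volume.restrict Ω] flux Ω b (σ - τ) + flux Ω b τ := by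
    filter_upwards [hσ.flux_sub (b := b) hΩ hτ] with x hx
    simp [hx]
  rw [← eLpNorm_congr_ae h3] at h2
  exact (add_le_add h1 h2).trans (by rw [tripleNorm, tripleNorm, add_add_add_comm])

theorem eLpNorm_inner_le {α F : Type*} [MeasurableSpace α] {μ : Measure α}
    [NormedAddCommGroup F] [InnerProductSpace ℝ F] {f g : α → F}
    (hf : AEStronglyMeasurable f μ) (hg : AEStronglyMeasurable g μ) (p q r : ℝ≥0∞)
    [ENNReal.HolderTriple p q r] :
    eLpNorm (fun x => inner ℝ (f x) (g x)) r μ ≤ eLpNorm f p μ * eLpNorm g q μ := by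
  simpa using eLpNorm_le_eLpNorm_mul_eLpNorm'_of_norm hf hg (fun a b => inner ℝ a b) 1
    (p := p) (q := q) (r := r)
    (.of_forall fun x => by simpa using norm_inner_le_norm (𝕜 := ℝ) (f x) (g x))

theorem aestronglyMeasurable_skewDensity {τ w v : EuclideanSpace ℝ (Fin d) → ℝ}
    (hb : AEStronglyMeasurable b (volume.restrict Ω))
    (hτ : MemH1 Ω τ) (hw : MemH1 Ω w) (hv : MemH1 Ω v) :
    AEStronglyMeasurable (skewDensity Ω b τ w v) (volume.restrict Ω) :=
  (hτ.memLp.1.mul (hw.memLp_grad.1.inner hv.memLp_grad.1)).add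
    ((AEStronglyMeasurable.inner (𝕜 := ℝ) (hτ.aestronglyMeasurable_flux hb)
      ((hv.memLp.1.smul hw.memLp_grad.1).sub (hw.memLp.1.smul hv.memLp_grad.1))).mul_const 2⁻¹)

theorem eLpNorm_skewDensity_le {p q : ℝ≥0∞} [hpq : ENNReal.HolderTriple p q 2] {C : ℝ≥0}
    {τ w v : EuclideanSpace ℝ (Fin d) → ℝ}
    (hb : AEStronglyMeasurable b (volume.restrict Ω))
    (hτ : MemH1 Ω τ) (hw : MemH1 Ω w) (hv : MemH1 Ω v)
    (hwq : eLpNorm w q (volume.restrict Ω)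
      ≤ C * eLpNorm (weakGrad Ω w) 2 (volume.restrict Ω))
    (hvq : eLpNorm v q (volume.restrict Ω)
      ≤ C * eLpNorm (weakGrad Ω v) 2 (volume.restrict Ω)) :
    eLpNorm (skewDensity Ω b τ w v) 1 (volume.restrict Ω) ≤
      (1 + 2 * C) * tripleNorm Ω b p τ * eLpNorm (weakGrad Ω w) 2 (volume.restrict Ω)
        * eLpNorm (weakGrad Ω v) 2 (volume.restrict Ω) := by
  set μ := volume.restrict Ω with hμ
  have hB : AEStronglyMeasurable (flux Ω b τ) μ := hτ.aestronglyMeasurable_flux hb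
  have hqp : ENNReal.HolderTriple q p 2 := hpq.symm
  set W := eLpNorm (weakGrad Ω w) 2 μ
  set V := eLpNorm (weakGrad Ω v) 2 μ
  set T := tripleNorm Ω b p τ with hT
  have hTτ : eLpNorm τ ⊤ μ ≤ T := le_self_add
  have hTB : eLpNorm (flux Ω b τ) p μ ≤ T := le_add_self
  have main : eLpNorm (fun x => τ x * inner ℝ (weakGrad Ω w x) (weakGrad Ω v x)) 1 μ
      ≤ T * W * V := by
    have h1 := eLpNorm_smul_le_mul_eLpNorm (p := ⊤) (q := 1) (r := 1)
      (hw.memLp_grad.1.inner (𝕜 := ℝ) hv.memLp_grad.1) hτ.memLp.1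
    have h2 := eLpNorm_inner_le hw.memLp_grad.1 hv.memLp_grad.1 2 2 1
    calc _ ≤ eLpNorm τ ⊤ μ * (W * V) := h1.trans (by gcongr)
      _ ≤ T * (W * V) := by gcongr
      _ = T * W * V := by ring
  -- The scalar y is moved onto the flux: y ∈ `L^q` and B ∈ `L^p` give yB ∈ `L²`, which pairs with
  -- ∇z.
  have cross : ∀ y z : EuclideanSpace ℝ (Fin d) → ℝ, MemH1 Ω y → MemH1 Ω z →
      eLpNorm y q μ ≤ C * eLpNorm (weakGrad Ω y) 2 μ →
      eLpNorm (fun x => inner ℝ (flux Ω b τ x) (y x • weakGrad Ω z x)) 1 μ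
        ≤ C * T * eLpNorm (weakGrad Ω y) 2 μ * eLpNorm (weakGrad Ω z) 2 μ := by
    intro y z hy hz hyq
    have h1 := eLpNorm_smul_le_mul_eLpNorm (p := q) (q := p) (r := 2) hB hy.memLp.1
    have h2 := eLpNorm_inner_le (hy.memLp.1.smul hB) hz.memLp_grad.1 2 2 1
    calc _ = eLpNorm (fun x => inner ℝ ((y • flux Ω b τ) x) (weakGrad Ω z x)) 1 μ := by
          simp [inner_smul_left, inner_smul_right]
      _ ≤ (C * eLpNorm (weakGrad Ω y) 2 μ * T) * eLpNorm (weakGrad Ω z) 2 μ :=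
          h2.trans (by gcongr; exact h1.trans (by gcongr))
      _ = _ := by ring
  have c1 := cross v w hv hw hvq
  have c2 := cross w v hw hv hwq
  have hm1 : AEStronglyMeasurable
      (fun x => inner ℝ (flux Ω b τ x) (v x • weakGrad Ω w x)) μ :=
    hB.inner (hv.memLp.1.smul hw.memLp_grad.1)
  have hm2 : AEStronglyMeasurable
      (fun x => inner ℝ (flux Ω b τ x) (w x • weakGrad Ω v x)) μ :=
    hB.inner (hw.memLp.1.smul hv.memLp_grad.1)
  have hdiv : eLpNorm (fun x => inner ℝ (flux Ω b τ x)
      (v x • weakGrad Ω w x - w x • weakGrad Ω v x) / 2) 1 μ ≤ 2 * C * T * W * V := by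
    calc _ ≤ eLpNorm ((fun x => inner ℝ (flux Ω b τ x) (v x • weakGrad Ω w x))
            - fun x => inner ℝ (flux Ω b τ x) (w x • weakGrad Ω v x)) 1 μ := by
          refine eLpNorm_mono fun x => ?_
          simp only [inner_sub_right, Pi.sub_apply, norm_div, Real.norm_ofNat]
          exact half_le_self (norm_nonneg _)
      _ ≤ C * T * V * W + C * T * W * V :=
          (eLpNorm_sub_le hm1 hm2 le_rfl).trans (add_le_add c1 c2)
      _ = _ := by ring
  calc _ ≤ T * W * V + 2 * C * T * W * V := by
        refine (eLpNorm_add_le (hτ.memLp.1.mul (hw.memLp_grad.1.inner hv.memLp_grad.1)) ?_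
          le_rfl).trans (add_le_add main hdiv)
        exact (AEStronglyMeasurable.inner (𝕜 := ℝ) hB ((hv.memLp.1.smul hw.memLp_grad.1).sub
          (hw.memLp.1.smul hv.memLp_grad.1))).mul_const 2⁻¹
    _ = _ := by ring

theorem enorm_integral_le_eLpNorm_one {α : Type*} [MeasurableSpace α] {μ : Measure α}
    (f : α → ℝ) : ‖∫ x, f x ∂μ‖ₑ ≤ eLpNorm f 1 μ := by
  rw [eLpNorm_one_eq_lintegral_enorm]
  exact enorm_integral_le_lintegral_enorm f

section Linear

variable {σ τ u v w : EuclideanSpace ℝ (Fin d) → ℝ}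

theorem skewForm_sub_weight (hΩ : IsOpen Ω) (hσ : MemH1 Ω σ) (hτ : MemH1 Ω τ)
    (h1 : Integrable (skewDensity Ω b σ u v) (volume.restrict Ω))
    (h2 : Integrable (skewDensity Ω b τ u v) (volume.restrict Ω)) :
    skewForm Ω b (σ - τ) u v = skewForm Ω b σ u v - skewForm Ω b τ u v := by
  rw [skewForm_eq, skewForm_eq, skewForm_eq, ← integral_sub h1 h2]
  refine integral_congr_ae ?_
  filter_upwards [hσ.flux_sub (b := b) hΩ hτ] with x hx
  simp only [skewDensity, hx, Pi.sub_apply, inner_sub_left]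
  ring

theorem skewForm_sub_left (hΩ : IsOpen Ω) (hu : MemH1 Ω u) (hw : MemH1 Ω w)
    (h1 : Integrable (skewDensity Ω b σ u v) (volume.restrict Ω))
    (h2 : Integrable (skewDensity Ω b σ w v) (volume.restrict Ω)) :
    skewForm Ω b σ (u - w) v = skewForm Ω b σ u v - skewForm Ω b σ w v := by
  rw [skewForm_eq, skewForm_eq, skewForm_eq, ← integral_sub h1 h2]
  refine integral_congr_ae ?_
  filter_upwards [hu.weakGrad_sub hΩ hw] with x hx
  simp only [skewDensity, hx, Pi.sub_apply, inner_sub_left, inner_sub_right, inner_smul_right]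
  ring

theorem skewForm_sub_right (hΩ : IsOpen Ω) (hv : MemH1 Ω v) (hw : MemH1 Ω w)
    (h1 : Integrable (skewDensity Ω b σ u v) (volume.restrict Ω))
    (h2 : Integrable (skewDensity Ω b σ u w) (volume.restrict Ω)) :
    skewForm Ω b σ u (v - w) = skewForm Ω b σ u v - skewForm Ω b σ u w := by
  rw [skewForm_eq, skewForm_eq, skewForm_eq, ← integral_sub h1 h2]
  refine integral_congr_ae ?_
  filter_upwards [hv.weakGrad_sub hΩ hw] with x hx
  simp only [skewDensity, hx, Pi.sub_apply, inner_sub_right, inner_smul_right]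
  ring

/-- The first-order part is antisymmetric in its two arguments, so it vanishes pointwise on the
diagonal, whatever the flux is. -/
theorem skewForm_self : skewForm Ω b σ w w
    = ∫ x in Ω, σ x * ‖weakGrad Ω w x‖ ^ 2 := by
  rw [skewForm]
  simp

end Linear

/-! ### Mollification: from smooth test functions to compactly supported `H¹` functions. -/

open scoped Convolution in
-- The derivative first falls on η; since t ↦ η(x - t) is itself a test function, the definition of
-- the weak gradient moves it onto v.
theorem HasWeakGradient.fderiv_convolution {v η : EuclideanSpace ℝ (Fin d) → ℝ}
    {g : EuclideanSpace ℝ (Fin d) → EuclideanSpace ℝ (Fin d)}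
    (h : HasWeakGradient Set.univ v g) (hη : ContDiff ℝ ∞ η) (hc : HasCompactSupport η)
    (x e : EuclideanSpace ℝ (Fin d)) :
    fderiv ℝ (v ⋆[ContinuousLinearMap.lsmul ℝ ℝ] η) x e
      = ∫ y, η y * inner ℝ (g (x - y)) e := by
  have hv : LocallyIntegrable v volume := locallyIntegrableOn_univ.1 h.locallyIntegrable
  rw [(hc.hasFDerivAt_convolution_right _ hv (hη.of_le (by simp)) x).fderiv,
    convolution_precompR_apply _ hv (hc.fderiv ℝ) (hη.continuous_fderiv (by simp)),
    convolution_def]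
  have hψ : IsTestFunction Set.univ (fun t => η (x - t)) :=
    ⟨hη.comp (contDiff_const.sub contDiff_id),
      hc.comp_homeomorph (Homeomorph.subLeft x), Set.subset_univ _⟩
  have hfd : ∀ t, fderiv ℝ (fun t => η (x - t)) t e = - fderiv ℝ η (x - t) e := by
    intro t
    have := ((hη.differentiable (by simp) (x - t)).hasFDerivAt.comp t
      ((hasFDerivAt_id t).const_sub x)).fderiv
    rw [show (fun t => η (x - t)) = η ∘ HSub.hSub x from rfl]
    simpa using congrArg (fun L => L e) this
  have key := h.integral_eq _ hψ e
  simp only [hfd, mul_neg, integral_neg, neg_inj, Measure.restrict_univ] at key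
  simp only [ContinuousLinearMap.lsmul_apply, smul_eq_mul]
  rw [key, ← integral_sub_left_eq_self _ volume x]
  refine integral_congr_ae (.of_forall fun y => ?_)
  simp [mul_comm]

theorem MeasureTheory.MemLp.integrable_inner {α F : Type*} [MeasurableSpace α] {μ : Measure α}
    [NormedAddCommGroup F] [InnerProductSpace ℝ F] {f g : α → F}
    (hf : MemLp f 2 μ) (hg : MemLp g 2 μ) : Integrable (fun x => inner ℝ (f x) (g x)) μ :=
  memLp_one_iff_integrable.1 ⟨hf.1.inner hg.1,
    (eLpNorm_inner_le hf.1 hg.1 2 2 1).trans_lt (ENNReal.mul_lt_top hf.2 hg.2)⟩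

/-- Translations act continuously on `L²`. -/
theorem continuous_integral_inner_translate {F : Type*} [NormedAddCommGroup F]
    [InnerProductSpace ℝ F] {f g : EuclideanSpace ℝ (Fin d) → F}
    (hf : MemLp f 2 volume) (hg : MemLp g 2 volume) :
    Continuous fun y => ∫ x, inner ℝ (f (x - y)) (g x) := by
  have hfact : Fact ((2 : ℝ≥0∞) ≠ ⊤) := ⟨by simp⟩
  have hcont : Continuous fun y : EuclideanSpace ℝ (Fin d) =>
      inner ℝ (DomAddAct.mk (-y) +ᵥ hf.toLp f) (hg.toLp g) := by
    refine Continuous.inner ?_ continuous_const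
    have : Continuous fun y : EuclideanSpace ℝ (Fin d) => DomAddAct.mk (-y) :=
      DomAddAct.continuous_mk.comp continuous_neg
    exact this.vadd continuous_const
  convert hcont using 2 with y
  rw [L2.inner_def]
  refine integral_congr_ae ?_
  rw [DomAddAct.mk_vadd_toLp]
  change _ =ᵐ[volume] fun x => inner ℝ ((MemLp.toLp (f ∘ fun x => -y +ᵥ x) _ : Lp F 2 volume) x) _
  filter_upwards [hg.coeFn_toLp, (hf.comp_measurePreserving
    (measurePreserving_vadd (-y) volume)).coeFn_toLp] with x h1 h2
  rw [h1, h2]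
  simp [sub_eq_neg_add]

open scoped Convolution Pointwise in
theorem isTestFunction_convolution {v η : EuclideanSpace ℝ (Fin d) → ℝ} {δ : ℝ}
    (hv : LocallyIntegrable v) (hvc : HasCompactSupport v)
    (hδΩ : Metric.cthickening δ (tsupport v) ⊆ Ω) (hη : ContDiff ℝ ∞ η)
    (hηc : HasCompactSupport η) (hηδ : tsupport η ⊆ Metric.ball 0 δ) :
    IsTestFunction Ω (v ⋆[ContinuousLinearMap.lsmul ℝ ℝ] η) := by
  refine ⟨?_, ?_, ?_⟩
  · exact hηc.contDiff_convolution_right (n := ⊤) _ hv hη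
  · exact hvc.convolution _ hηc
  · have hK : IsClosed (tsupport v + tsupport η) := (IsCompact.add hvc hηc).isClosed
    refine (closure_minimal ((support_convolution_subset _).trans
      (Set.add_subset_add (subset_tsupport _) (subset_tsupport _))) hK).trans ?_
    rintro _ ⟨a, ha, c, hc, rfl⟩
    refine hδΩ (Metric.mem_cthickening_of_dist_le _ a _ _ ha ?_)
    simpa using (mem_ball_zero_iff.1 (hηδ hc)).le

/-- Justifies Fubini below: a convolution integrand of two integrable functions, times the bounded
factor η. -/
theorem integrable_mul_translate {F : Type*} [NormedAddCommGroup F] [NormedSpace ℝ F]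
    (L : F →L[ℝ] F →L[ℝ] ℝ) {f g : EuclideanSpace ℝ (Fin d) → F}
    {η : EuclideanSpace ℝ (Fin d) → ℝ}
    (hf : Integrable f) (hg : Integrable g) (hη : Continuous η) (hηc : HasCompactSupport η) :
    Integrable (fun z : EuclideanSpace ℝ (Fin d) × EuclideanSpace ℝ (Fin d) =>
        η z.2 * L (f z.1) (g (z.1 - z.2))) (volume.prod volume) := by
  obtain ⟨M, hM⟩ := hηc.exists_bound_of_continuous hη
  have h := (hf.convolution_integrand L hg.comp_neg).swap
  refine Integrable.bdd_mul (c := M) ?_ (hη.comp continuous_snd).aestronglyMeasurable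
    (.of_forall fun z => hM _)
  simpa only [Function.comp_def, Prod.swap, neg_sub] using h

open scoped Convolution in
/-- A weak identity tested with smooth functions extends to compactly supported `H¹` functions. -/
theorem HasWeakGradient.integral_eq_zero_of_test (hΩ : IsOpen Ω)
    {v h : EuclideanSpace ℝ (Fin d) → ℝ}
    {g G : EuclideanSpace ℝ (Fin d) → EuclideanSpace ℝ (Fin d)}
    (hv : HasWeakGradient Set.univ v g) (hvc : HasCompactSupport v) (hvΩ : tsupport v ⊆ Ω)
    (hv1 : Integrable v) (hg1 : Integrable g) (hv2 : MemLp v 2 volume) (hg2 : MemLp g 2 volume)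
    (hh2 : MemLp h 2 volume) (hG2 : MemLp G 2 volume) (hh1 : Integrable h) (hG1 : Integrable G)
    (htest : ∀ ψ, IsTestFunction Ω ψ → ∫ x, (fderiv ℝ ψ x (G x) + h x * ψ x) = 0) :
    ∫ x, (inner ℝ (g x) (G x) + v x * h x) = 0 := by
  -- The claim is F(0) = 0, where F pairs the translates of v and g with h and G. By Fubini, ∫ ηF is
  -- the hypothesis tested with v ⋆ η, so F vanishes almost everywhere near 0; F being continuous,
  -- it vanishes at 0. No convergence of mollifiers is needed.
  set F : EuclideanSpace ℝ (Fin d) → ℝ := fun y =>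
    (∫ x, inner ℝ (g (x - y)) (G x)) + ∫ x, v (x - y) * h x with hF
  have hFc : Continuous F := by
    refine (continuous_integral_inner_translate hg2 hG2).add ?_
    simpa [mul_comm] using continuous_integral_inner_translate hv2 hh2
  obtain ⟨δ, hδ, hδΩ⟩ := hvc.exists_cthickening_subset_open hΩ hvΩ
  have hFint : ∀ η : EuclideanSpace ℝ (Fin d) → ℝ, ContDiff ℝ ∞ η → HasCompactSupport η →
      tsupport η ⊆ Metric.ball 0 δ → ∫ y, η y • F y = 0 := by
    intro η hη hηc hηδ
    have htf : IsTestFunction Ω (v ⋆[ContinuousLinearMap.lsmul ℝ ℝ] η) :=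
      isTestFunction_convolution hv1.locallyIntegrable hvc hδΩ hη hηc hηδ
    have h0 := htest _ htf
    have hconv : ∀ x, (v ⋆[ContinuousLinearMap.lsmul ℝ ℝ] η) x = ∫ y, v (x - y) * η y := by
      intro x
      rw [convolution_def, ← integral_sub_left_eq_self _ volume x]
      simp
    have hi1 : Integrable (fun z : EuclideanSpace ℝ (Fin d) × EuclideanSpace ℝ (Fin d) =>
        η z.2 * inner ℝ (g (z.1 - z.2)) (G z.1)) (volume.prod volume) := by
      simp_rw [← real_inner_comm _ (G _)]
      exact integrable_mul_translate (innerSL ℝ) hG1 hg1 hη.continuous hηc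
    have hi2 : Integrable (fun z : EuclideanSpace ℝ (Fin d) × EuclideanSpace ℝ (Fin d) =>
        η z.2 * (v (z.1 - z.2) * h z.1)) (volume.prod volume) := by
      simpa [mul_comm] using
        integrable_mul_translate (ContinuousLinearMap.mul ℝ ℝ) hh1 hv1 hη.continuous hηc
    have e1 : ∫ y, η y • F y = ∫ y, ∫ x, (η y * inner ℝ (g (x - y)) (G x)
        + η y * (v (x - y) * h x)) := by
      refine integral_congr_ae ?_
      filter_upwards [hi1.prod_left_ae, hi2.prod_left_ae] with y hy1 hy2
      rw [integral_add hy1 hy2, integral_const_mul, integral_const_mul, ← mul_add, smul_eq_mul]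
    rw [e1, ← integral_integral_swap (hi1.add hi2), ← h0]
    refine integral_congr_ae ?_
    filter_upwards [hi1.prod_right_ae, hi2.prod_right_ae] with x hx1 hx2
    rw [integral_add hx1 hx2, hv.fderiv_convolution hη hηc, hconv,
      ← integral_const_mul]
    congr 1
    refine integral_congr_ae (.of_forall fun y => ?_)
    ring
  have hae := Metric.isOpen_ball.ae_eq_zero_of_integral_contDiff_smul_eq_zero
    (hFc.locallyIntegrable.locallyIntegrableOn _) hFint
  have hF0 : F 0 = 0 := by
    have hEq : Set.EqOn F 0 (Metric.ball 0 δ) := by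
      refine Measure.eqOn_open_of_ae_eq (μ := volume) ?_ Metric.isOpen_ball hFc.continuousOn
        continuousOn_const
      rw [Filter.EventuallyEq, ae_restrict_iff' Metric.isOpen_ball.measurableSet]
      exact hae
    exact hEq (Metric.mem_ball_self hδ)
  rw [← hF0, hF]
  simp only [sub_zero]
  exact integral_add (hg2.integrable_inner hG2) (by
    simpa [mul_comm] using hv2.integrable_inner hh2)

namespace IsTestFunction

variable {φ ψ : EuclideanSpace ℝ (Fin d) → ℝ}

theorem gradient_eq_zero (h : IsTestFunction Ω φ) {x : EuclideanSpace ℝ (Fin d)} (hx : x ∉ Ω) :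
    gradient φ x = 0 := by
  have : fderiv ℝ φ x = 0 := by
    by_contra hne
    exact hx (h.support_subset (support_fderiv_subset ℝ hne))
  simp [gradient, this]

theorem eq_zero (h : IsTestFunction Ω φ) {x : EuclideanSpace ℝ (Fin d)} (hx : x ∉ Ω) :
    φ x = 0 :=
  image_eq_zero_of_notMem_tsupport fun hx' => hx (h.support_subset hx')

theorem fderiv_apply (φ : EuclideanSpace ℝ (Fin d) → ℝ) (x e : EuclideanSpace ℝ (Fin d)) :
    fderiv ℝ φ x e = inner ℝ (gradient φ x) e := by
  simp [gradient]

theorem memLp_top (h : IsTestFunction Ω φ) (μ : Measure (EuclideanSpace ℝ (Fin d)))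
    [IsLocallyFiniteMeasure μ] : MemLp φ ⊤ μ :=
  h.smooth.continuous.memLp_of_hasCompactSupport h.compact

theorem memLp_top_gradient (h : IsTestFunction Ω φ)
    (μ : Measure (EuclideanSpace ℝ (Fin d))) [IsLocallyFiniteMeasure μ] :
    MemLp (gradient φ) ⊤ μ :=
  h.continuous_gradient.memLp_of_hasCompactSupport h.hasCompactSupport_gradient

theorem sub (hφ : IsTestFunction Ω φ) (hψ : IsTestFunction Ω ψ) : IsTestFunction Ω (φ - ψ) where
  smooth := hφ.smooth.sub hψ.smooth
  compact := hφ.compact.sub hψ.compact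
  support_subset := (tsupport_sub φ ψ).trans (Set.union_subset hφ.support_subset
    hψ.support_subset)

end IsTestFunction

/-- The product of a test function with a weakly differentiable function is weakly differentiable
on the whole space. -/
theorem HasWeakGradient.testFunction_mul {σ φ : EuclideanSpace ℝ (Fin d) → ℝ}
    {g : EuclideanSpace ℝ (Fin d) → EuclideanSpace ℝ (Fin d)}
    (hσ : HasWeakGradient Ω σ g) (hφ : IsTestFunction Ω φ) :
    HasWeakGradient Set.univ (fun x => φ x * σ x)
      (fun x => φ x • g x + σ x • gradient φ x) := by
  have hφσ := hσ.locallyIntegrable.integrable_smul_of_hasCompactSupport hφ.smooth.continuous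
    hφ.compact hφ.support_subset
  have hφg := hσ.locallyIntegrable_grad.integrable_smul_of_hasCompactSupport
    hφ.smooth.continuous hφ.compact hφ.support_subset
  have hsupp : tsupport (gradient φ) ⊆ Ω := by
    refine (closure_minimal (fun x hx => ?_) (isClosed_tsupport φ)).trans hφ.support_subset
    by_contra hx'
    refine hx (IsTestFunction.gradient_eq_zero (Ω := tsupport φ)
      ⟨hφ.smooth, hφ.compact, le_rfl⟩ hx')
  have hσφ : Integrable (fun x => σ x • gradient φ x) := by
    have h1 : IntegrableOn (fun x => σ x • gradient φ x) (tsupport (gradient φ)) volume :=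
      (hσ.locallyIntegrable.integrableOn_compact_subset hsupp
        hφ.hasCompactSupport_gradient).smul_continuousOn
        hφ.continuous_gradient.continuousOn hφ.hasCompactSupport_gradient
    rw [← integrableOn_iff_integrable_of_support_subset (s := tsupport (gradient φ))]
    · exact h1
    · intro x hx
      by_contra hx'
      exact hx (by simp [image_eq_zero_of_notMem_tsupport hx'])
  refine ⟨locallyIntegrableOn_univ.2 hφσ.locallyIntegrable,
    locallyIntegrableOn_univ.2 (hφg.add hσφ).locallyIntegrable, fun ψ hψ e => ?_⟩
  -- Although ψ need not be supported in Ω, φψ is, so it may be used to test σ; the classical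
  -- product rule for φψ then yields the one for φσ.
  have hprod : IsTestFunction Ω (fun x => φ x * ψ x) := hφ.mul_smooth hψ.smooth
  have key := hσ.integral_eq _ hprod e
  have hi1 := hσ.integrable_mul_fderiv hprod e
  have hi2 := hσ.integrable_inner_mul hprod e
  obtain ⟨M, hM⟩ := hψ.compact.exists_bound_of_continuous hψ.smooth.continuous
  have hi3 : Integrable (fun x => ψ x * inner ℝ (σ x • gradient φ x) e) (volume.restrict Ω) :=
    ((hσφ.inner_const (𝕜 := ℝ) e).bdd_mul (c := M) hψ.smooth.continuous.aestronglyMeasurable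
      (.of_forall hM)).restrict
  have hz1 : ∫ x in Ω, φ x * σ x * fderiv ℝ ψ x e = ∫ x, φ x * σ x * fderiv ℝ ψ x e :=
    setIntegral_eq_integral_of_forall_compl_eq_zero fun x hx => by
      rw [hφ.eq_zero hx, zero_mul, zero_mul]
  have hz2 : ∫ x in Ω, inner ℝ (φ x • g x + σ x • gradient φ x) e * ψ x
      = ∫ x, inner ℝ (φ x • g x + σ x • gradient φ x) e * ψ x :=
    setIntegral_eq_integral_of_forall_compl_eq_zero fun x hx => by
      rw [hφ.eq_zero hx, hφ.gradient_eq_zero hx, zero_smul, smul_zero, add_zero,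
        inner_zero_left, zero_mul]
  rw [Measure.restrict_univ, ← hz1, ← hz2]
  have hleft : ∀ x, φ x * σ x * fderiv ℝ ψ x e
      = σ x * fderiv ℝ (fun x => φ x * ψ x) x e - ψ x * inner ℝ (σ x • gradient φ x) e := by
    intro x
    rw [fderiv_fun_mul (hφ.differentiable x) (hψ.differentiable x), inner_smul_left,
      ← IsTestFunction.fderiv_apply]
    simp
    ring
  have hright : ∀ x, inner ℝ (φ x • g x + σ x • gradient φ x) e * ψ x
      = inner ℝ (g x) e * (φ x * ψ x) + ψ x * inner ℝ (σ x • gradient φ x) e := by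
    intro x
    rw [inner_add_left, inner_smul_left]
    simp
    ring
  simp only [hleft, hright]
  rw [integral_sub hi1 hi3, integral_add hi2 hi3, key]
  ring

/-! ### Consistency: the weak solution and the invariant measure, tested with test functions. -/

theorem Real.eq_zero_of_enorm_le_tendsto {x : ℝ} {K : ℝ≥0∞} (hK : K ≠ ⊤) {e : ℕ → ℝ≥0∞}
    (he : Filter.Tendsto e Filter.atTop (nhds 0)) (h : ∀ n, ‖x‖ₑ ≤ K * e n) : x = 0 := by
  have hT := ENNReal.Tendsto.const_mul (a := K) he (Or.inr hK)
  rw [mul_zero] at hT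
  have := ge_of_tendsto' hT h
  simpa using this

theorem MemH10.sub (hΩ : IsOpen Ω) {u v : EuclideanSpace ℝ (Fin d) → ℝ} (hu : MemH10 Ω u)
    (hv : MemH10 Ω v) : MemH10 Ω (u - v) where
  memH1 := hu.memH1.sub hΩ hv.memH1
  approx := by
    intro ε hε
    -- The `H¹` norm is bounded by the sum of two `L²` norms, each of which receives a contribution
    -- from u and one from v.
    have h4 : 0 < ε / 4 := ENNReal.div_pos hε.ne' (by norm_num)
    obtain ⟨φ, hφ, hφε⟩ := hu.approx _ h4
    obtain ⟨ψ, hψ, hψε⟩ := hv.approx _ h4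
    refine ⟨φ - ψ, hφ.sub hψ, ?_⟩
    have hU := hu.memH1.sub hΩ (hφ.memH1 hΩ)
    have hV := hv.memH1.sub hΩ (hψ.memH1 hΩ)
    have heq : u - v - (φ - ψ) = (u - φ) - (v - ψ) := by abel
    rw [heq]
    have h1 : eLpNorm ((u - φ) - (v - ψ)) 2 (volume.restrict Ω) ≤ ε / 4 + ε / 4 :=
      (eLpNorm_sub_le hU.memLp.1 hV.memLp.1 (by norm_num)).trans
        (add_le_add ((eLpNorm_le_eH1norm _ _).trans hφε.le)
          ((eLpNorm_le_eH1norm _ _).trans hψε.le))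
    have h2 : eLpNorm (weakGrad Ω ((u - φ) - (v - ψ))) 2 (volume.restrict Ω) < ε / 4 + ε / 4 := by
      rw [eLpNorm_congr_ae (hU.weakGrad_sub hΩ hV)]
      exact (eLpNorm_sub_le hU.memLp_grad.1 hV.memLp_grad.1 (by norm_num)).trans_lt
        (ENNReal.add_lt_add ((eLpNorm_weakGrad_le_eH1norm _ _).trans_lt hφε)
          ((eLpNorm_weakGrad_le_eH1norm _ _).trans_lt hψε))
    have h3 : (ε / 4 + ε / 4) + (ε / 4 + ε / 4) = ε := by
      rw [← two_mul, ← two_mul, ← mul_assoc, show (2 : ℝ≥0∞) * 2 = 4 by norm_num,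
        ENNReal.mul_div_cancel (by norm_num) (by norm_num)]
    refine (eH1norm_le _ _).trans_lt ?_
    rw [← h3]
    exact ENNReal.add_lt_add_of_le_of_lt (hU.sub hΩ hV).memLp.2.ne h1 h2

theorem eH1norm_zero (hΩ : IsOpen Ω) : eH1norm Ω (0 : EuclideanSpace ℝ (Fin d) → ℝ) = 0 := by
  have h : HasWeakGradient Ω (0 : EuclideanSpace ℝ (Fin d) → ℝ) 0 :=
    ⟨locallyIntegrableOn_zero, locallyIntegrableOn_zero, by simp⟩
  have := eH1norm_le Ω (0 : EuclideanSpace ℝ (Fin d) → ℝ)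
  rw [eLpNorm_congr_ae (h.weakGrad_ae_eq hΩ)] at this
  simpa using this

theorem IsTestFunction.memH10 (hΩ : IsOpen Ω) {φ : EuclideanSpace ℝ (Fin d) → ℝ}
    (hφ : IsTestFunction Ω φ) : MemH10 Ω φ :=
  ⟨hφ.memH1 hΩ, fun ε hε => ⟨φ, hφ, by rwa [sub_self, eH1norm_zero hΩ]⟩⟩

/-- If `B` is distributionally divergence free, then `∫ B · ∇(φ u) = 0`. -/
theorem MemH10.integral_inner_eq_zero (hΩ : IsOpen Ω)
    {B : EuclideanSpace ℝ (Fin d) → EuclideanSpace ℝ (Fin d)}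
    (hB : MemLp B 2 (volume.restrict Ω))
    (hdiv : ∀ φ, IsTestFunction Ω φ → ∫ x in Ω, fderiv ℝ φ x (B x) = 0)
    {u φ : EuclideanSpace ℝ (Fin d) → ℝ} (hu : MemH10 Ω u) (hφ : IsTestFunction Ω φ) :
    Integrable (fun x => inner ℝ (φ x • weakGrad Ω u x + u x • gradient φ x) (B x))
      (volume.restrict Ω) ∧
    ∫ x in Ω, inner ℝ (φ x • weakGrad Ω u x + u x • gradient φ x) (B x) = 0 := by
  set μ := volume.restrict Ω with hμ
  have hmem : ∀ w, MemH1 Ω w →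
      MemLp (fun x => φ x • weakGrad Ω w x + w x • gradient φ x) 2 μ := fun w hw =>
    (hw.memLp_grad.smul (hφ.memLp_top μ)).add ((hφ.memLp_top_gradient μ).smul hw.memLp)
  have hint : ∀ w, MemH1 Ω w →
      Integrable (fun x => inner ℝ (φ x • weakGrad Ω w x + w x • gradient φ x) (B x)) μ :=
    fun w hw => (hmem w hw).integrable_inner hB
  refine ⟨hint u hu.memH1, ?_⟩
  obtain ⟨ψ, hψ, hlim⟩ := hu.exists_seq
  set K := (eLpNorm φ ⊤ μ + eLpNorm (gradient φ) ⊤ μ) * eLpNorm B 2 μ with hK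
  refine Real.eq_zero_of_enorm_le_tendsto (K := K) (ENNReal.mul_ne_top (ENNReal.add_ne_top.2
    ⟨(hφ.memLp_top μ).2.ne, (hφ.memLp_top_gradient μ).2.ne⟩) hB.2.ne) hlim fun n => ?_
  have hψ1 := (hψ n).memH1 hΩ
  have hdiff := hu.memH1.sub hΩ hψ1
  -- For the smooth approximants ψ n of u, the product φ ψ n is a test function and the divergence
  -- condition applies directly.
  have hz : ∫ x in Ω, inner ℝ (φ x • weakGrad Ω (ψ n) x + (ψ n) x • gradient φ x) (B x) = 0 := by
    rw [← hdiv _ (hφ.mul_smooth (hψ n).smooth)]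
    refine integral_congr_ae ?_
    filter_upwards [(hψ n).weakGrad_ae_eq hΩ] with x hx
    rw [fderiv_fun_mul (hφ.differentiable x) ((hψ n).differentiable x), hx, inner_add_left,
      inner_smul_left, inner_smul_left, ← IsTestFunction.fderiv_apply,
      ← IsTestFunction.fderiv_apply]
    simp
  have heq : ∫ x in Ω, inner ℝ (φ x • weakGrad Ω u x + u x • gradient φ x) (B x)
      = ∫ x in Ω, inner ℝ (φ x • weakGrad Ω (u - ψ n) x + (u - ψ n) x • gradient φ x) (B x) := by
    rw [← sub_zero (∫ x in Ω, inner ℝ (φ x • weakGrad Ω u x + u x • gradient φ x) (B x)), ← hz,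
      ← integral_sub (hint u hu.memH1) (hint _ hψ1)]
    refine integral_congr_ae ?_
    filter_upwards [hu.memH1.weakGrad_sub hΩ hψ1] with x hx
    simp only [hx, Pi.sub_apply, smul_sub, sub_smul, inner_add_left, inner_sub_left]
    ring
  rw [heq]
  have h1 := eLpNorm_smul_le_mul_eLpNorm (p := ⊤) (q := 2) (r := 2) hdiff.memLp_grad.1
    (hφ.memLp_top μ).1
  have h2 := eLpNorm_smul_le_mul_eLpNorm (p := 2) (q := ⊤) (r := 2)
    (hφ.memLp_top_gradient μ).1 hdiff.memLp.1
  calc _ ≤ _ := enorm_integral_le_eLpNorm_one _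
    _ ≤ _ := eLpNorm_inner_le (hmem _ hdiff).1 hB.1 2 2 1
    _ ≤ (eLpNorm φ ⊤ μ * eH1norm Ω (u - ψ n) + eH1norm Ω (u - ψ n) * eLpNorm (gradient φ) ⊤ μ)
          * eLpNorm B 2 μ := by
        gcongr
        refine (eLpNorm_add_le ((hφ.memLp_top μ).1.smul hdiff.memLp_grad.1)
          (hdiff.memLp.1.smul (hφ.memLp_top_gradient μ).1) (by norm_num)).trans ?_
        refine add_le_add (h1.trans ?_) (h2.trans ?_)
        · gcongr
          exact eLpNorm_weakGrad_le_eH1norm _ _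
        · gcongr
          exact eLpNorm_le_eH1norm _ _
    _ = _ := by rw [hK]; ring

theorem LipschitzOnWith.memLp_top_restrict (hΩ : IsOpen Ω) (hbd : Bornology.IsBounded Ω)
    {K : ℝ≥0} (hb : LipschitzOnWith K b (closure Ω)) : MemLp b ⊤ (volume.restrict Ω) := by
  have hb' := hb.mono subset_closure
  obtain ⟨M, hM⟩ := hbd.isCompact_closure.exists_bound_of_continuousOn hb.continuousOn
  refine memLp_top_of_bound (hb'.continuousOn.aestronglyMeasurable hΩ.measurableSet) M ?_
  filter_upwards [ae_restrict_mem hΩ.measurableSet] with x hx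
  exact hM _ (subset_closure hx)

theorem MemH1.memLp_flux {σ : EuclideanSpace ℝ (Fin d) → ℝ} (hσ : MemH1 Ω σ)
    (hb : MemLp b ⊤ (volume.restrict Ω)) : MemLp (flux Ω b σ) 2 (volume.restrict Ω) :=
  hσ.memLp_grad.add (hb.smul hσ.memLp)

theorem IsWeakSolution.integral_test_eq_zero (hΩ : IsOpen Ω)
    (hb : MemLp b ⊤ (volume.restrict Ω)) {f u : EuclideanSpace ℝ (Fin d) → ℝ}
    (hf : MemLp f 2 (volume.restrict Ω)) (hu : IsWeakSolution Ω b f u)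
    {ψ : EuclideanSpace ℝ (Fin d) → ℝ} (hψ : IsTestFunction Ω ψ) :
    ∫ x in Ω, (fderiv ℝ ψ x (weakGrad Ω u x)
      + (inner ℝ (b x) (weakGrad Ω u x) - f x) * ψ x) = 0 := by
  have hgu := hu.memH10.memH1.memLp_grad
  have hψ1 := hψ.memH1 hΩ
  have hbg : MemLp (fun x => inner ℝ (b x) (weakGrad Ω u x)) 2 (volume.restrict Ω) :=
    ⟨hb.1.inner hgu.1, (eLpNorm_inner_le hb.1 hgu.1 ⊤ 2 2).trans_lt
      (ENNReal.mul_lt_top hb.2 hgu.2)⟩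
  have hi1 : Integrable (fun x => inner ℝ (weakGrad Ω u x) (weakGrad Ω ψ x)
      + inner ℝ (b x) (weakGrad Ω u x) * ψ x) (volume.restrict Ω) :=
    (hgu.integrable_inner hψ1.memLp_grad).add (hbg.integrable_mul hψ1.memLp)
  have hi2 : Integrable (fun x => f x * ψ x) (volume.restrict Ω) := hf.integrable_mul hψ1.memLp
  have key := hu.eq ψ (hψ.memH10 hΩ)
  rw [advDiffForm, ← sub_eq_zero, ← integral_sub hi1 hi2] at key
  rw [← key]
  refine integral_congr_ae ?_
  filter_upwards [hψ.weakGrad_ae_eq hΩ] with x hx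
  rw [hx, IsTestFunction.fderiv_apply, real_inner_comm (gradient ψ x)]
  ring

/-- This is the weak equation tested with φσ, which is compactly supported in Ω and weakly
differentiable, so the mollification result applies with G = ∇u and h = b · ∇u - f. -/
theorem IsWeakSolution.integral_mul_testFunction_eq_zero (hΩ : IsOpen Ω)
    (hbd : Bornology.IsBounded Ω)
    (hb : MemLp b ⊤ (volume.restrict Ω)) {f u : EuclideanSpace ℝ (Fin d) → ℝ}
    (hf : MemLp f 2 (volume.restrict Ω)) (hu : IsWeakSolution Ω b f u)
    {σ φ : EuclideanSpace ℝ (Fin d) → ℝ} (hσ : MemH1 Ω σ) (hφ : IsTestFunction Ω φ) :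
    ∫ x in Ω, (inner ℝ (φ x • weakGrad Ω σ x + σ x • gradient φ x) (weakGrad Ω u x)
      + φ x * σ x * (inner ℝ (b x) (weakGrad Ω u x) - f x)) = 0 := by
  have hfin : IsFiniteMeasure (volume.restrict Ω) := ⟨by simpa using hbd.measure_lt_top⟩
  set μ := volume.restrict Ω with hμ
  have hgu := hu.memH10.memH1.memLp_grad
  have hv2 : MemLp (fun x => φ x * σ x) 2 μ := hσ.memLp.mul (hφ.memLp_top μ)
  have hg2 : MemLp (fun x => φ x • weakGrad Ω σ x + σ x • gradient φ x) 2 μ :=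
    (hσ.memLp_grad.smul (hφ.memLp_top μ)).add ((hφ.memLp_top_gradient μ).smul hσ.memLp)
  have hh2 : MemLp (fun x => inner ℝ (b x) (weakGrad Ω u x) - f x) 2 μ :=
    MemLp.sub ⟨hb.1.inner hgu.1, (eLpNorm_inner_le hb.1 hgu.1 ⊤ 2 2).trans_lt
      (ENNReal.mul_lt_top hb.2 hgu.2)⟩ hf
  -- The mollification result lives on the whole space. Here φσ and its gradient already vanish
  -- outside Ω, while ∇u and b · ∇u - f are extended by zero.
  have iv : Ω.indicator (fun x => φ x * σ x) = fun x => φ x * σ x :=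
    Set.indicator_eq_self.2 fun x hx => by
      by_contra hx'
      exact hx (by simp [hφ.eq_zero hx'])
  have ig : Ω.indicator (fun x => φ x • weakGrad Ω σ x + σ x • gradient φ x)
      = fun x => φ x • weakGrad Ω σ x + σ x • gradient φ x :=
    Set.indicator_eq_self.2 fun x hx => by
      by_contra hx'
      exact hx (by simp [hφ.eq_zero hx', hφ.gradient_eq_zero hx'])
  have hm := hΩ.measurableSet
  have key := (hσ.hasWeakGradient.testFunction_mul hφ).integral_eq_zero_of_test hΩ
    (h := Ω.indicator fun x => inner ℝ (b x) (weakGrad Ω u x) - f x)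
    (G := Ω.indicator (weakGrad Ω u))
    hφ.compact.mul_right ((tsupport_mul_subset_left).trans hφ.support_subset)
    (by rw [← iv, integrable_indicator_iff hm]; exact hv2.integrable (by norm_num))
    (by rw [← ig, integrable_indicator_iff hm]; exact hg2.integrable (by norm_num))
    (by rw [← iv, memLp_indicator_iff_restrict hm]; exact hv2)
    (by rw [← ig, memLp_indicator_iff_restrict hm]; exact hg2)
    (by rw [memLp_indicator_iff_restrict hm]; exact hh2)
    (by rw [memLp_indicator_iff_restrict hm]; exact hgu)
    (by rw [integrable_indicator_iff hm]; exact hh2.integrable (by norm_num))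
    (by rw [integrable_indicator_iff hm]; exact hgu.integrable (by norm_num))
    (fun ψ hψ => by
      rw [← hu.integral_test_eq_zero hΩ hb hf hψ,
        ← setIntegral_eq_integral_of_forall_compl_eq_zero (s := Ω)
          (fun x hx => by simp [hψ.eq_zero hx, hx])]
      refine setIntegral_congr_fun hm fun x hx => ?_
      simp [hx])
  rw [← setIntegral_eq_integral_of_forall_compl_eq_zero (s := Ω)
    (fun x hx => by simp [hx])] at key
  rw [← key]
  refine setIntegral_congr_fun hm fun x hx => ?_
  simp [hx]

/-- With B = ∇σ + σb one has ∇(φσ) · ∇u + φσ b · ∇u = σ ∇u · ∇φ + φ B · ∇u. Subtracting B · ∇(φu)/2,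
which integrates to zero, leaves exactly the integrand of the skew form. -/
theorem IsInvariantMeasure.skewForm_test (hΩ : IsOpen Ω) (hbd : Bornology.IsBounded Ω)
    (hb : MemLp b ⊤ (volume.restrict Ω)) {f u σ φ : EuclideanSpace ℝ (Fin d) → ℝ}
    (hf : MemLp f 2 (volume.restrict Ω)) (hu : IsWeakSolution Ω b f u)
    (hσ : IsInvariantMeasure Ω b σ) (hφ : IsTestFunction Ω φ) :
    skewForm Ω b σ u φ = ∫ x in Ω, f x * (σ x * φ x) := by
  set μ := volume.restrict Ω with hμ
  have hgu := hu.memH10.memH1.memLp_grad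
  have hv2 : MemLp (fun x => φ x * σ x) 2 μ := hσ.memH1.memLp.mul (hφ.memLp_top μ)
  have hg2 : MemLp (fun x => φ x • weakGrad Ω σ x + σ x • gradient φ x) 2 μ :=
    (hσ.memH1.memLp_grad.smul (hφ.memLp_top μ)).add
      ((hφ.memLp_top_gradient μ).smul hσ.memH1.memLp)
  have hh2 : MemLp (fun x => inner ℝ (b x) (weakGrad Ω u x) - f x) 2 μ :=
    MemLp.sub ⟨hb.1.inner hgu.1, (eLpNorm_inner_le hb.1 hgu.1 ⊤ 2 2).trans_lt
      (ENNReal.mul_lt_top hb.2 hgu.2)⟩ hf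
  have hI1 : Integrable (fun x =>
      inner ℝ (φ x • weakGrad Ω σ x + σ x • gradient φ x) (weakGrad Ω u x)
      + φ x * σ x * (inner ℝ (b x) (weakGrad Ω u x) - f x)) μ :=
    (hg2.integrable_inner hgu).add (hv2.integrable_mul hh2)
  obtain ⟨hI2, hE2⟩ := hu.memH10.integral_inner_eq_zero hΩ (hσ.memH1.memLp_flux hb)
    hσ.div_eq_zero hφ
  have hE1 := hu.integral_mul_testFunction_eq_zero hΩ hbd hb hf hσ.memH1 hφ
  have hI3 : Integrable (fun x => f x * (σ x * φ x)) μ := by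
    refine (hf.integrable_mul hv2).congr (.of_forall fun x => ?_)
    simp only [Pi.mul_apply]
    ring
  have hI2' := hI2.div_const 2
  have hE2' : ∫ x in Ω, inner ℝ (φ x • weakGrad Ω u x + u x • gradient φ x) (flux Ω b σ x) / 2
      = 0 := by
    rw [integral_div, hE2, zero_div]
  calc skewForm Ω b σ u φ
      = ∫ x in Ω, ((inner ℝ (φ x • weakGrad Ω σ x + σ x • gradient φ x) (weakGrad Ω u x)
          + φ x * σ x * (inner ℝ (b x) (weakGrad Ω u x) - f x))
          - inner ℝ (φ x • weakGrad Ω u x + u x • gradient φ x) (flux Ω b σ x) / 2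
          + f x * (σ x * φ x)) := by
        refine integral_congr_ae ?_
        filter_upwards [hφ.weakGrad_ae_eq hΩ] with x hx
        rw [hx]
        simp only [flux, inner_add_left, inner_add_right, inner_sub_right, inner_smul_left,
          inner_smul_right, conj_trivial]
        rw [real_inner_comm (gradient φ x) (weakGrad Ω u x),
          real_inner_comm (gradient φ x) (weakGrad Ω σ x),
          real_inner_comm (weakGrad Ω u x) (weakGrad Ω σ x),
          real_inner_comm (gradient φ x) (b x), real_inner_comm (weakGrad Ω u x) (b x)]
        ring
    _ = _ := by
        refine (integral_add (hI1.sub hI2') hI3).trans ?_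
        rw [integral_sub' hI1 hI2', hE1, hE2', sub_zero, zero_add]

/-! ### Coercivity, and consistency for all of `H¹₀(Ω)`. -/

/-- A real function without an essential lower bound has `essInf` equal to the default value `sSup ∅
= 0`; positivity excludes this. -/
theorem ae_essInf_le_of_pos {α : Type*} [MeasurableSpace α] {μ : Measure α} {f : α → ℝ}
    (h : 0 < essInf f μ) : ∀ᵐ x ∂μ, essInf f μ ≤ f x := by
  refine ae_essInf_le ?_
  by_contra hbd
  have hempty : {a : ℝ | ∀ᵐ x ∂μ, a ≤ f x} = ∅ :=
    Set.eq_empty_of_forall_notMem fun a ha => hbd ⟨a, by simpa using ha⟩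
  rw [essInf, Filter.liminf_eq, hempty, Real.sSup_empty] at h
  exact h.false

theorem eLpNorm_two_sq {α F : Type*} [MeasurableSpace α] {μ : Measure α} [NormedAddCommGroup F]
    (f : α → F) : eLpNorm f 2 μ ^ 2 = ∫⁻ x, ‖f x‖ₑ ^ 2 ∂μ := by
  simpa using eLpNorm_nnreal_pow_eq_lintegral (f := f) (μ := μ) (p := 2) (by norm_num)

theorem integrable_skewDensity {p q : ℝ≥0∞} [ENNReal.HolderTriple p q 2] {C : ℝ≥0}
    (hS : ∀ w, MemH10 Ω w → eLpNorm w q (volume.restrict Ω)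
      ≤ C * eLpNorm (weakGrad Ω w) 2 (volume.restrict Ω))
    (hb : AEStronglyMeasurable b (volume.restrict Ω))
    {τ w v : EuclideanSpace ℝ (Fin d) → ℝ} (hτ : MemH1 Ω τ) (hτp : tripleNorm Ω b p τ < ⊤)
    (hw : MemH10 Ω w) (hv : MemH10 Ω v) :
    Integrable (skewDensity Ω b τ w v) (volume.restrict Ω) :=
  memLp_one_iff_integrable.1 ⟨aestronglyMeasurable_skewDensity hb hτ hw.memH1 hv.memH1,
    (eLpNorm_skewDensity_le (p := p) hb hτ hw.memH1 hv.memH1 (hS w hw) (hS v hv)).trans_lt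
      (ENNReal.mul_lt_top (ENNReal.mul_lt_top (ENNReal.mul_lt_top
        (by simpa using ENNReal.mul_lt_top (by simp) ENNReal.coe_lt_top) hτp)
        hw.memH1.memLp_grad.2) hv.memH1.memLp_grad.2)⟩

theorem enorm_skewForm_le {p q : ℝ≥0∞} [ENNReal.HolderTriple p q 2] {C : ℝ≥0}
    (hS : ∀ w, MemH10 Ω w → eLpNorm w q (volume.restrict Ω)
      ≤ C * eLpNorm (weakGrad Ω w) 2 (volume.restrict Ω))
    (hb : AEStronglyMeasurable b (volume.restrict Ω))
    {τ w v : EuclideanSpace ℝ (Fin d) → ℝ} (hτ : MemH1 Ω τ)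
    (hw : MemH10 Ω w) (hv : MemH10 Ω v) :
    ‖skewForm Ω b τ w v‖ₑ ≤ (1 + 2 * C) * tripleNorm Ω b p τ
      * eLpNorm (weakGrad Ω w) 2 (volume.restrict Ω)
      * eLpNorm (weakGrad Ω v) 2 (volume.restrict Ω) :=
  (enorm_integral_le_eLpNorm_one _).trans
    (eLpNorm_skewDensity_le (p := p) hb hτ hw.memH1 hv.memH1 (hS w hw) (hS v hv))

theorem memLp_top_of_tripleNorm {p : ℝ≥0∞} {τ : EuclideanSpace ℝ (Fin d) → ℝ} (hτ : MemH1 Ω τ)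
    (h : tripleNorm Ω b p τ < ⊤) : MemLp τ ⊤ (volume.restrict Ω) :=
  ⟨hτ.memLp.1, le_self_add.trans_lt h⟩

theorem ofReal_essInf_mul_le_enorm_skewForm {τ w : EuclideanSpace ℝ (Fin d) → ℝ}
    (hτ : 0 < essInf τ (volume.restrict Ω))
    (hint : Integrable (skewDensity Ω b τ w w) (volume.restrict Ω)) :
    ENNReal.ofReal (essInf τ (volume.restrict Ω))
      * eLpNorm (weakGrad Ω w) 2 (volume.restrict Ω) ^ 2 ≤ ‖skewForm Ω b τ w w‖ₑ := by
  have hae := ae_essInf_le_of_pos hτ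
  have hint' : Integrable (fun x => τ x * ‖weakGrad Ω w x‖ ^ 2) (volume.restrict Ω) := by
    refine hint.congr (.of_forall fun x => ?_)
    simp [skewDensity]
  rw [skewForm_self, Real.enorm_eq_ofReal, ofReal_integral_eq_lintegral_ofReal hint',
    eLpNorm_two_sq, ← lintegral_const_mul' _ _ ENNReal.ofReal_ne_top]
  · refine lintegral_mono_ae ?_
    filter_upwards [hae] with x hx
    rw [ENNReal.ofReal_mul (hτ.le.trans hx), ENNReal.ofReal_pow (norm_nonneg _), ofReal_norm]
    gcongr
  · filter_upwards [hae] with x hx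
    exact mul_nonneg (hτ.le.trans hx) (sq_nonneg _)
  · refine integral_nonneg_of_ae ?_
    filter_upwards [hae] with x hx
    exact mul_nonneg (hτ.le.trans hx) (sq_nonneg _)

theorem MeasureTheory.MemLp.integrable_mul_mul {α : Type*} [MeasurableSpace α] {μ : Measure α}
    {f σ w : α → ℝ} (hf : MemLp f 2 μ) (hσ : MemLp σ ⊤ μ) (hw : MemLp w 2 μ) :
    Integrable (fun x => f x * (σ x * w x)) μ :=
  hf.integrable_mul (hw.mul hσ : MemLp (σ * w) 2 μ)

theorem enorm_integral_mul_mul_le {α : Type*} [MeasurableSpace α] {μ : Measure α}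
    {f σ w : α → ℝ} (hf : AEStronglyMeasurable f μ) (hσ : AEStronglyMeasurable σ μ)
    (hw : AEStronglyMeasurable w μ) (p q : ℝ≥0∞) [ENNReal.HolderTriple p q 2] :
    ‖∫ x, f x * (σ x * w x) ∂μ‖ₑ ≤ eLpNorm f 2 μ * (eLpNorm σ p μ * eLpNorm w q μ) := by
  have h1 : eLpNorm (σ • w) 2 μ ≤ eLpNorm σ p μ * eLpNorm w q μ :=
    eLpNorm_smul_le_mul_eLpNorm hw hσ
  have h2 : eLpNorm (f • (σ • w)) 1 μ ≤ eLpNorm f 2 μ * eLpNorm (σ • w) 2 μ :=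
    eLpNorm_smul_le_mul_eLpNorm (hσ.smul hw) hf
  exact (enorm_integral_le_eLpNorm_one _).trans (h2.trans (by gcongr))

/-- A weak solution solves the skew-symmetrised problem weighted with the invariant measure. -/
theorem IsInvariantMeasure.skewForm_weakSolution {p q : ℝ≥0∞} [ENNReal.HolderTriple p q 2]
    {C : ℝ≥0}
    (hS : ∀ w, MemH10 Ω w → eLpNorm w q (volume.restrict Ω)
      ≤ C * eLpNorm (weakGrad Ω w) 2 (volume.restrict Ω))
    (hΩ : IsOpen Ω) (hbd : Bornology.IsBounded Ω)
    (hb : MemLp b ⊤ (volume.restrict Ω)) {f u σ v : EuclideanSpace ℝ (Fin d) → ℝ}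
    (hf : MemLp f 2 (volume.restrict Ω)) (hu : IsWeakSolution Ω b f u)
    (hσ : IsInvariantMeasure Ω b σ) (hσp : tripleNorm Ω b p σ < ⊤) (hv : MemH10 Ω v) :
    skewForm Ω b σ u v = ∫ x in Ω, f x * (σ x * v x) := by
  obtain ⟨ψ, hψ, hlim⟩ := hv.exists_seq
  rw [← sub_eq_zero]
  set μ := volume.restrict Ω with hμ
  have hσt := memLp_top_of_tripleNorm hσ.memH1 hσp
  -- Lipschitz constant, in the `H¹` norm of v, of the difference of the two sides. That difference
  -- vanishes on test functions, and K is finite because the triple norm of σ is.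
  set K := (1 + 2 * C) * tripleNorm Ω b p σ * eLpNorm (weakGrad Ω u) 2 μ
    + eLpNorm f 2 μ * eLpNorm σ ⊤ μ with hK
  have hKt : K ≠ ⊤ := ENNReal.add_ne_top.2 ⟨ENNReal.mul_ne_top (ENNReal.mul_ne_top
    (by simpa using ENNReal.mul_ne_top (by simp) ENNReal.coe_ne_top) hσp.ne)
    hu.memH10.memH1.memLp_grad.2.ne, ENNReal.mul_ne_top hf.2.ne hσt.2.ne⟩
  refine Real.eq_zero_of_enorm_le_tendsto hKt hlim fun n => ?_
  have hψ0 := (hψ n).memH10 hΩ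
  have hd := hv.sub hΩ hψ0
  have e1 := skewForm_sub_right hΩ hv.memH1 hψ0.memH1
    (integrable_skewDensity hS hb.1 hσ.memH1 hσp hu.memH10 hv)
    (integrable_skewDensity hS hb.1 hσ.memH1 hσp hu.memH10 hψ0)
  have e2 : ∫ x in Ω, f x * (σ x * (v - ψ n) x)
      = (∫ x in Ω, f x * (σ x * v x)) - ∫ x in Ω, f x * (σ x * ψ n x) := by
    rw [← integral_sub (hf.integrable_mul_mul hσt hv.memH1.memLp)
      (hf.integrable_mul_mul hσt hψ0.memH1.memLp)]
    refine integral_congr_ae (.of_forall fun x => ?_)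
    simp only [Pi.sub_apply]
    ring
  have e3 : skewForm Ω b σ u v - ∫ x in Ω, f x * (σ x * v x)
      = skewForm Ω b σ u (v - ψ n) - ∫ x in Ω, f x * (σ x * (v - ψ n) x) := by
    rw [e1, e2, hσ.skewForm_test hΩ hbd hb hf hu (hψ n)]
    ring
  rw [e3]
  calc _ ≤ ‖skewForm Ω b σ u (v - ψ n)‖ₑ + ‖∫ x in Ω, f x * (σ x * (v - ψ n) x)‖ₑ :=
        enorm_sub_le
    _ ≤ (1 + 2 * C) * tripleNorm Ω b p σ * eLpNorm (weakGrad Ω u) 2 μ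
          * eLpNorm (weakGrad Ω (v - ψ n)) 2 μ
        + eLpNorm f 2 μ * (eLpNorm σ ⊤ μ * eLpNorm (v - ψ n) 2 μ) :=
        add_le_add (enorm_skewForm_le hS hb.1 hσ.memH1 hu.memH10 hd)
          (enorm_integral_mul_mul_le hf.1 hσt.1 hd.memH1.memLp.1 ⊤ 2)
    _ ≤ (1 + 2 * C) * tripleNorm Ω b p σ * eLpNorm (weakGrad Ω u) 2 μ
          * eH1norm Ω (v - ψ n)
        + eLpNorm f 2 μ * (eLpNorm σ ⊤ μ * eH1norm Ω (v - ψ n)) := by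
        gcongr
        · exact eLpNorm_weakGrad_le_eH1norm _ _
        · exact eLpNorm_le_eH1norm _ _
    _ = _ := by rw [hK]; ring

/-! ### The Strang estimate and the degenerate case. -/

section Estimate

variable {p q : ℝ≥0∞} [ENNReal.HolderTriple p q 2] {C : ℝ≥0}
  {f σ σh u uH vH : EuclideanSpace ℝ (Fin d) → ℝ}
  {UH : Submodule ℝ (EuclideanSpace ℝ (Fin d) → ℝ)}

theorem IsDiscreteSolution.ofReal_essInf_mul_le
    (hS : ∀ w, MemH10 Ω w → eLpNorm w q (volume.restrict Ω)
      ≤ C * eLpNorm (weakGrad Ω w) 2 (volume.restrict Ω))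
    (hΩ : IsOpen Ω) (hbd : Bornology.IsBounded Ω) (hb : MemLp b ⊤ (volume.restrict Ω))
    (hf : MemLp f 2 (volume.restrict Ω)) (hu : IsWeakSolution Ω b f u)
    (hσ : IsInvariantMeasure Ω b σ) (hσp : tripleNorm Ω b p σ < ⊤)
    (hσh : MemH1 Ω σh) (hσhp : tripleNorm Ω b p σh < ⊤)
    (hpos : 0 < essInf σh (volume.restrict Ω)) (hUH : ∀ v ∈ UH, MemH10 Ω v)
    (huH : IsDiscreteSolution Ω b f σh UH uH) (hvH : vH ∈ UH) :
    ENNReal.ofReal (essInf σh (volume.restrict Ω))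
      * eLpNorm (weakGrad Ω (uH - vH)) 2 (volume.restrict Ω) ≤
      (1 + 2 * C) * (eLpNorm f 2 (volume.restrict Ω) * eLpNorm (σ - σh) p (volume.restrict Ω)
        + tripleNorm Ω b p σ * eH1norm Ω (u - vH)
        + tripleNorm Ω b p (σ - σh) * eH1norm Ω vH) := by
  set μ := volume.restrict Ω with hμ
  have hwU : uH - vH ∈ UH := UH.sub_mem huH.mem hvH
  set w := uH - vH with hw
  have hw0 : MemH10 Ω w := hUH _ hwU
  have hv0 := hUH _ hvH
  have huH0 := hUH _ huH.mem
  have hσt := memLp_top_of_tripleNorm hσ.memH1 hσp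
  have hσht := memLp_top_of_tripleNorm hσh hσhp
  have hi : ∀ {y z}, MemH10 Ω y → MemH10 Ω z → Integrable (skewDensity Ω b σ y z) μ :=
    integrable_skewDensity hS hb.1 hσ.memH1 hσp
  have hih : ∀ {y z}, MemH10 Ω y → MemH10 Ω z → Integrable (skewDensity Ω b σh y z) μ :=
    integrable_skewDensity hS hb.1 hσh hσhp
  have e1 := skewForm_sub_left hΩ huH0.memH1 hv0.memH1 (hih huH0 hw0) (hih hv0 hw0)
  have e2 := skewForm_sub_left hΩ hu.memH10.memH1 hv0.memH1 (hi hu.memH10 hw0) (hi hv0 hw0)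
  have e3 := skewForm_sub_weight hΩ hσ.memH1 hσh (hi hv0 hw0) (hih hv0 hw0)
  have e4 : ∫ x in Ω, f x * ((σ - σh) x * w x)
      = (∫ x in Ω, f x * (σ x * w x)) - ∫ x in Ω, f x * (σh x * w x) := by
    rw [← integral_sub (hf.integrable_mul_mul hσt hw0.memH1.memLp)
      (hf.integrable_mul_mul hσht hw0.memH1.memLp)]
    refine integral_congr_ae (.of_forall fun x => ?_)
    simp only [Pi.sub_apply]
    ring
  rw [hσ.skewForm_weakSolution hS hΩ hbd hb hf hu hσp hw0] at e2
  rw [huH.eq w hwU] at e1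
  -- The error identity: the discrete equation removes u_H, and consistency replaces ∫ f σ w by
  -- a_ss(σ;u,w).
  have key : skewForm Ω b σh w w = skewForm Ω b σ (u - vH) w + skewForm Ω b (σ - σh) vH w
      - ∫ x in Ω, f x * ((σ - σh) x * w x) := by
    rw [e2, e3, e4]
    exact e1.trans (by ring)
  have hcoer := ofReal_essInf_mul_le_enorm_skewForm hpos (hih hw0 hw0)
  set W := eLpNorm (weakGrad Ω w) 2 μ with hW
  have hWt : W ≠ ⊤ := hw0.memH1.memLp_grad.2.ne
  have hupper : ‖skewForm Ω b σh w w‖ₑ ≤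
      ((1 + 2 * C) * (eLpNorm f 2 μ * eLpNorm (σ - σh) p μ
        + tripleNorm Ω b p σ * eH1norm Ω (u - vH)
        + tripleNorm Ω b p (σ - σh) * eH1norm Ω vH)) * W := by
    rw [key]
    calc _ ≤ ‖skewForm Ω b σ (u - vH) w‖ₑ + ‖skewForm Ω b (σ - σh) vH w‖ₑ
          + ‖∫ x in Ω, f x * ((σ - σh) x * w x)‖ₑ :=
          enorm_sub_le.trans (by gcongr; exact enorm_add_le _ _)
      _ ≤ (1 + 2 * C) * tripleNorm Ω b p σ * eLpNorm (weakGrad Ω (u - vH)) 2 μ * W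
          + (1 + 2 * C) * tripleNorm Ω b p (σ - σh) * eLpNorm (weakGrad Ω vH) 2 μ * W
          + eLpNorm f 2 μ * (eLpNorm (σ - σh) p μ * eLpNorm w q μ) :=
          add_le_add (add_le_add
            (enorm_skewForm_le hS hb.1 hσ.memH1 (hu.memH10.sub hΩ hv0) hw0)
            (enorm_skewForm_le hS hb.1 (hσ.memH1.sub hΩ hσh) hv0 hw0))
            (enorm_integral_mul_mul_le hf.1 (hσt.1.sub hσht.1) hw0.memH1.memLp.1 p q)
      _ ≤ (1 + 2 * C) * tripleNorm Ω b p σ * eH1norm Ω (u - vH) * W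
          + (1 + 2 * C) * tripleNorm Ω b p (σ - σh) * eH1norm Ω vH * W
          + eLpNorm f 2 μ * (eLpNorm (σ - σh) p μ * ((1 + 2 * C) * W)) := by
          have hC : (C : ℝ≥0∞) ≤ 1 + 2 * C := by
            rw [two_mul, ← add_assoc]; exact le_add_self
          have hwq : eLpNorm w q μ ≤ (1 + 2 * C) * W := (hS w hw0).trans (by gcongr)
          gcongr
          · exact eLpNorm_weakGrad_le_eH1norm _ _
          · exact eLpNorm_weakGrad_le_eH1norm _ _
      _ = _ := by ring
  -- Coercivity is quadratic in W and the upper bound linear, so one finite factor W is cancelled.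
  rcases eq_or_ne W 0 with h0 | h0
  · rw [h0, mul_zero]
    exact zero_le
  · rw [← ENNReal.mul_le_mul_iff_left h0 hWt]
    calc _ = _ := by rw [mul_assoc, ← sq]
      _ ≤ _ := hcoer.trans hupper

/-- Both terms of the bilinear form contain ∇u, so f is orthogonal to every test function. -/
theorem IsWeakSolution.ae_eq_zero_of_weakGrad_ae_eq_zero (hΩ : IsOpen Ω)
    (hbd : Bornology.IsBounded Ω)
    (hf : MemLp f 2 (volume.restrict Ω)) (hu : IsWeakSolution Ω b f u)
    (h0 : weakGrad Ω u =ᵐ[volume.restrict Ω] 0) : f =ᵐ[volume.restrict Ω] 0 := by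
  have hfin : IsFiniteMeasure (volume.restrict Ω) := ⟨by simpa using hbd.measure_lt_top⟩
  have hfi : IntegrableOn f Ω volume := hf.integrable (by norm_num)
  rw [Filter.EventuallyEq, ae_restrict_iff' hΩ.measurableSet]
  refine hΩ.ae_eq_zero_of_integral_contDiff_smul_eq_zero hfi.locallyIntegrableOn ?_
  intro φ h1 h2 h3
  have hφ : IsTestFunction Ω φ := ⟨h1, h2, h3⟩
  have key := hu.eq φ (hφ.memH10 hΩ)
  have hz : advDiffForm Ω b u φ = 0 := by
    refine integral_eq_zero_of_ae ?_
    filter_upwards [h0] with x hx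
    simp [hx]
  rw [hz] at key
  rw [← setIntegral_eq_integral_of_forall_compl_eq_zero (s := Ω)
    fun x hx => by simp [hφ.eq_zero hx], key]
  simp [mul_comm]

/-- The two `L²` norms of w are kept apart so that Poincaré's inequality can absorb the first into
the second. -/
theorem eH1norm_sub_le_add (hΩ : IsOpen Ω) {v w : EuclideanSpace ℝ (Fin d) → ℝ}
    (hv : MemH1 Ω v) (hw : MemH1 Ω w) :
    eH1norm Ω (v - w) ≤ 2 * eH1norm Ω v + (eLpNorm w 2 (volume.restrict Ω)
      + eLpNorm (weakGrad Ω w) 2 (volume.restrict Ω)) := by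
  refine (eH1norm_le _ _).trans ?_
  rw [eLpNorm_congr_ae (hv.weakGrad_sub hΩ hw)]
  refine (add_le_add (eLpNorm_sub_le hv.memLp.1 hw.memLp.1 (by norm_num))
    (eLpNorm_sub_le hv.memLp_grad.1 hw.memLp_grad.1 (by norm_num))).trans ?_
  rw [add_add_add_comm, two_mul]
  gcongr
  · exact eLpNorm_le_eH1norm _ _
  · exact eLpNorm_weakGrad_le_eH1norm _ _

theorem weakGrad_ae_eq_zero_of_eH1norm (hu : MemH1 Ω u) (h : eH1norm Ω u = 0) :
    weakGrad Ω u =ᵐ[volume.restrict Ω] 0 :=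
  (eLpNorm_eq_zero_iff hu.memLp_grad.1 (by norm_num)).1
    (le_antisymm ((eLpNorm_weakGrad_le_eH1norm _ _).trans h.le) zero_le)

/-- If both `u - vH` and `vH` vanish, then so does the discrete solution. -/
theorem IsDiscreteSolution.eH1norm_sub_eq_zero
    (hS : ∀ w, MemH10 Ω w → eLpNorm w q (volume.restrict Ω)
        ≤ C * eLpNorm (weakGrad Ω w) 2 (volume.restrict Ω) ∧
      eLpNorm w 2 (volume.restrict Ω)
        ≤ C * eLpNorm (weakGrad Ω w) 2 (volume.restrict Ω))
    (hΩ : IsOpen Ω) (hbd : Bornology.IsBounded Ω) (hb : MemLp b ⊤ (volume.restrict Ω))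
    (hf : MemLp f 2 (volume.restrict Ω)) (hu : IsWeakSolution Ω b f u)
    (hσh : MemH1 Ω σh) (hσhp : tripleNorm Ω b p σh < ⊤)
    (hpos : 0 < essInf σh (volume.restrict Ω)) (hUH : ∀ v ∈ UH, MemH10 Ω v)
    (huH : IsDiscreteSolution Ω b f σh UH uH) (hvH : vH ∈ UH)
    (h1 : eH1norm Ω (u - vH) = 0) (h2 : eH1norm Ω vH = 0) : eH1norm Ω (u - uH) = 0 := by
  have hv0 := hUH _ hvH
  have huH0 := hUH _ huH.mem
  have hg1 := weakGrad_ae_eq_zero_of_eH1norm (hu.memH10.memH1.sub hΩ hv0.memH1) h1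
  have hg2 := weakGrad_ae_eq_zero_of_eH1norm hv0.memH1 h2
  have hgu : weakGrad Ω u =ᵐ[volume.restrict Ω] 0 := by
    filter_upwards [hg1, hg2, hu.memH10.memH1.weakGrad_sub hΩ hv0.memH1] with x hx1 hx2 hx3
    simpa [hx1, hx2, eq_comm] using hx3
  have hf0 := hu.ae_eq_zero_of_weakGrad_ae_eq_zero hΩ hbd hf hgu
  have hskew : skewForm Ω b σh uH uH = 0 := by
    rw [huH.eq uH huH.mem]
    refine integral_eq_zero_of_ae ?_
    filter_upwards [hf0] with x hx
    simp [hx]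
  have hcoer := ofReal_essInf_mul_le_enorm_skewForm hpos
    (integrable_skewDensity (fun w hw => (hS w hw).1) hb.1 hσh hσhp huH0 huH0)
  rw [hskew, enorm_zero, nonpos_iff_eq_zero, mul_eq_zero] at hcoer
  have hG : eLpNorm (weakGrad Ω uH) 2 (volume.restrict Ω) = 0 := by
    rcases hcoer with h | h
    · exact absurd h (by simpa using hpos)
    · simpa using h
  have hu2 : eLpNorm uH 2 (volume.restrict Ω) = 0 := by
    simpa [hG] using (hS uH huH0).2
  have hU0 : eH1norm Ω u = 0 := by
    have h3 := eLpNorm_add_le (hu.memH10.memH1.sub hΩ hv0.memH1).memLp.1 hv0.memH1.memLp.1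
      (p := 2) (by norm_num)
    rw [sub_add_cancel] at h3
    have h4 : eLpNorm u 2 (volume.restrict Ω) ≤ 0 := by
      refine h3.trans ((add_le_add (eLpNorm_le_eH1norm _ _) (eLpNorm_le_eH1norm _ _)).trans ?_)
      rw [h1, h2, add_zero]
    have h5 := eH1norm_le Ω u
    rw [eLpNorm_congr_ae hgu, nonpos_iff_eq_zero.1 h4] at h5
    simpa using h5
  have := eH1norm_sub_le_add hΩ hu.memH10.memH1 huH0.memH1
  simpa [hG, hu2, hU0] using this

end Estimate

end

/-! ### The quasi-optimal error estimate. -/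

theorem proposition3p4 (d : ℕ) (hd2 : 2 ≤ d) (hd3 : d ≤ 3)
    (Ω : Set (EuclideanSpace ℝ (Fin d)))
    (hΩ_open : IsOpen Ω) (hΩ_bdd : Bornology.IsBounded Ω) (hΩ_conn : IsConnected Ω)
    (hΩ_conv : Convex ℝ Ω) (hΩ_poly : IsConvexPolyhedral Ω)
    (p : ℝ≥0∞) (hp : (d : ℝ≥0∞) < p) :
    ∃ C : ℝ≥0,
      ∀ (b : EuclideanSpace ℝ (Fin d) → EuclideanSpace ℝ (Fin d)),
        (∃ K : ℝ≥0, LipschitzOnWith K b (closure Ω)) →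
      ∀ (σ : EuclideanSpace ℝ (Fin d) → ℝ), IsInvariantMeasure Ω b σ →
      ∀ (σh : EuclideanSpace ℝ (Fin d) → ℝ), MemH1 Ω σh → tripleNorm Ω b p σh < ⊤ →
        0 < essInf σh (volume.restrict Ω) →
      ∀ (f : EuclideanSpace ℝ (Fin d) → ℝ), MemLp f 2 (volume.restrict Ω) →
      ∀ (UH : Submodule ℝ (EuclideanSpace ℝ (Fin d) → ℝ)), (∀ v ∈ UH, MemH10 Ω v) →
      ∀ (u uH : EuclideanSpace ℝ (Fin d) → ℝ),
        IsWeakSolution Ω b f u → IsDiscreteSolution Ω b f σh UH uH →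
        eH1norm Ω (u - uH) ≤
          C / ENNReal.ofReal (essInf σh (volume.restrict Ω))
              * eLpNorm f 2 (volume.restrict Ω) * eLpNorm (σ - σh) p (volume.restrict Ω)
            + C * ⨅ vH ∈ UH,
                ((1 + tripleNorm Ω b p σ / ENNReal.ofReal (essInf σh (volume.restrict Ω)))
                    * eH1norm Ω (u - vH)
                  + tripleNorm Ω b p (σ - σh)
                      / ENNReal.ofReal (essInf σh (volume.restrict Ω)) * eH1norm Ω vH) := by
  obtain ⟨q, hpq, C, hS⟩ := MemH10.exists_sobolev hd2 hΩ_open hΩ_bdd hp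
  -- The factor 1 + C comes from Poincaré's inequality, 1 + 2C from continuity of the form, and the
  -- summand 2 from the triangle inequality through v_H.
  refine ⟨(1 + C) * (1 + 2 * C) + 2, ?_⟩
  intro b ⟨L, hL⟩ σ hσ σh hσh hσhp hpos f hf UH hUH u uH hu huH
  have hb := hL.memLp_top_restrict hΩ_open hΩ_bdd
  set m := ENNReal.ofReal (essInf σh (volume.restrict Ω)) with hm
  have hm0 : m ≠ 0 := by simpa [hm] using hpos
  have hmt : m ≠ ⊤ := ENNReal.ofReal_ne_top
  set D : ℝ≥0 := (1 + C) * (1 + 2 * C) + 2 with hD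
  have hD2 : (2 : ℝ≥0∞) ≤ D := by
    rw [hD, ENNReal.coe_add]
    exact le_add_self
  have hD0 : (D : ℝ≥0∞) ≠ 0 := fun h => by simp [h] at hD2
  have hDC : ((1 + C) * (1 + 2 * C) : ℝ≥0∞) ≤ D := by
    rw [hD]
    push_cast
    exact le_self_add
  rw [ENNReal.mul_iInf_of_ne hD0 ENNReal.coe_ne_top, ENNReal.add_iInf]
  refine le_iInf fun vH => ?_
  rw [ENNReal.mul_iInf_of_ne hD0 ENNReal.coe_ne_top, ENNReal.add_iInf]
  refine le_iInf fun hvH => ?_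
  have hv0 := hUH _ hvH
  have huH0 := hUH _ huH.mem
  have hp1 : 1 ≤ p := le_trans (by exact_mod_cast (by omega : 1 ≤ d)) hp.le
  rcases lt_or_ge (tripleNorm Ω b p σ) ⊤ with hσp | hσp
  · have key := huH.ofReal_essInf_mul_le (fun w hw => (hS w hw).1) hΩ_open hΩ_bdd hb hf hu hσ hσp
      hσh hσhp hpos hUH hvH
    rw [← hm] at key
    set W := eLpNorm (weakGrad Ω (uH - vH)) 2 (volume.restrict Ω)
    set F := eLpNorm f 2 (volume.restrict Ω)
    set S := eLpNorm (σ - σh) p (volume.restrict Ω)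
    set T := tripleNorm Ω b p σ
    set T' := tripleNorm Ω b p (σ - σh)
    set U := eH1norm Ω (u - vH)
    set V := eH1norm Ω vH
    have hW : W ≤ (1 + 2 * C) * (F * S + T * U + T' * V) / m := by
      rwa [ENNReal.le_div_iff_mul_le (.inl hm0) (.inl hmt), mul_comm]
    have hw0 : MemH10 Ω (uH - vH) := hUH _ (UH.sub_mem huH.mem hvH)
    have htri := eH1norm_sub_le_add hΩ_open (hu.memH10.memH1.sub hΩ_open hv0.memH1) hw0.memH1
    rw [sub_sub_sub_cancel_right] at htri
    calc eH1norm Ω (u - uH) ≤ _ := htri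
      _ ≤ D * U + (C * W + W) := by
          gcongr
          exact (hS _ hw0).2
      _ = D * U + (1 + C) * W := by ring
      _ ≤ D * U + (1 + C) * ((1 + 2 * C) * (F * S + T * U + T' * V) / m) := by gcongr
      _ = D * U + (1 + C) * (1 + 2 * C) * ((F * S + T * U + T' * V) / m) := by
          simp only [div_eq_mul_inv]; ring
      _ ≤ D * U + D * ((F * S + T * U + T' * V) / m) := by gcongr
      _ = D / m * F * S + D * ((1 + T / m) * U + T' / m * V) := by
          simp only [div_eq_mul_inv]; ring
  -- Consistency is not available here. Both coefficients in the bracket are infinite, so the bound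
  -- is trivial unless 0 · ∞ = 0 intervenes in both terms.
  · have hT : tripleNorm Ω b p σ = ⊤ := top_le_iff.1 hσp
    have hT' : tripleNorm Ω b p (σ - σh) = ⊤ := by
      by_contra hne
      have := hσ.memH1.tripleNorm_le_add hΩ_open hp1 hσh hb.1
      rw [hT, top_le_iff] at this
      exact (ENNReal.add_ne_top.2 ⟨hne, hσhp.ne⟩) this
    rw [hT, hT', ENNReal.top_div_of_ne_top hmt, add_top]
    by_cases h1 : eH1norm Ω (u - vH) = 0
    · by_cases h2 : eH1norm Ω vH = 0
      · rw [huH.eH1norm_sub_eq_zero hS hΩ_open hΩ_bdd hb hf hu hσh hσhp hpos hUH hvH h1 h2]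
        exact zero_le
      · simp [ENNReal.top_mul h2, ENNReal.mul_top hD0]
    · simp [ENNReal.top_mul h1, ENNReal.mul_top hD0]
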